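/- Let $n \ge 2$, let $\Omega \subset \mathbb{R}^n$ be open, and let $\varphi \in W^{1,n}_{\mathrm{loc}}(\Omega)$ be real-valued. Suppose that $\varphi$ is $\alpha$-almost weakly monotone for some $\alpha > 0$; that is, there is a constant $C > 0$ such that, whenever $B_r$ is an open ball of radius $r > 0$ that is compactly contained in $\Omega$ and $M, m \in \mathbb{R}$ are such that $$(\varphi|_{B_r} - M)^+ \in W^{1,1}_0(B_r) \quad\text{and}\quad (m - \varphi|_{B_r})^+ \in W^{1,1}_0(B_r),$$ then $$\|(\varphi|_{B_r} - M)^+\|_{L^\infty(B_r)} \le C r^{\alpha} \quad\text{and}\quad \|(m - \varphi|_{B_r})^+\|_{L^\infty(B_r)} \le C r^{\alpha}.$$ Then $\varphi$ has a continuous representative: there is a continuous function $\psi \colon \Omega \to \mathbb{R}$ with $\varphi = \psi$ almost everywhere in $\Omega$. Here $t^+ = \max(t, 0)$, and $W^{1,1}_0(B_r)$ is the closure of $C^\infty_c(B_r)$ in $W^{1,1}(B_r)$. -/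

import Mathlib

open MeasureTheory Set Metric
open scoped ENNReal ContDiff

/-- `η ∈ C_c^∞(Ω)`: smooth functions whose support is a compact subset of `Ω`. Here and below, `E`
stands for the Euclidean space `ℝⁿ` with its Lebesgue measure `volume`; the definitions use only its
structure of a normed space with a measure. -/
def IsTestFunctionOn {E : Type*} [NormedAddCommGroup E] [NormedSpace ℝ E]
    (Ω : Set E) (η : E → ℝ) : Prop :=
  ContDiff ℝ ∞ η ∧ HasCompactSupport η ∧ tsupport η ⊆ Ω

/-- `G` is the weak derivative of `u` in the open set `Ω`. The derivative at a point is a linear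
functional on `E`; its operator norm is the norm of the weak gradient. -/
def HasWeakDerivOn {E : Type*} [NormedAddCommGroup E] [NormedSpace ℝ E] [MeasureSpace E]
    (Ω : Set E) (u : E → ℝ) (G : E → (E →L[ℝ] ℝ)) : Prop :=
  LocallyIntegrableOn u Ω volume ∧ LocallyIntegrableOn G Ω volume ∧
    ∀ η : E → ℝ, IsTestFunctionOn Ω η →
      ∀ v : E,
        ∫ x in Ω, u x * fderiv ℝ η x v = -∫ x in Ω, G x v * η x

/-- `u ∈ W^{1,p}(Ω)`, for `Ω` open and `1 ≤ p`; only the values of `u` in `Ω` matter. -/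
def MemW1 {E : Type*} [NormedAddCommGroup E] [NormedSpace ℝ E] [MeasureSpace E]
    (Ω : Set E) (p : ℝ≥0∞) (u : E → ℝ) : Prop :=
  ∃ G : E → (E →L[ℝ] ℝ),
    HasWeakDerivOn Ω u G ∧ MemLp u p (volume.restrict Ω) ∧ MemLp G p (volume.restrict Ω)

/-- `u ∈ W^{1,p}_loc(Ω)`: `u` is in `W^{1,p}(U)` for every open `U` compactly contained in `Ω`. -/
def MemW1Loc {E : Type*} [NormedAddCommGroup E] [NormedSpace ℝ E] [MeasureSpace E]
    (Ω : Set E) (p : ℝ≥0∞) (u : E → ℝ) : Prop :=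
  ∀ U : Set E, IsOpen U → IsCompact (closure U) → closure U ⊆ Ω →
    MemW1 U p u

/-- `u ∈ W^{1,p}_0(Ω)`: `u` is in the closure of `C_c^∞(Ω)` in `W^{1,p}(Ω)`. -/
def MemW1Zero {E : Type*} [NormedAddCommGroup E] [NormedSpace ℝ E] [MeasureSpace E]
    (Ω : Set E) (p : ℝ≥0∞) (u : E → ℝ) : Prop :=
  ∃ G : E → (E →L[ℝ] ℝ),
    HasWeakDerivOn Ω u G ∧ MemLp u p (volume.restrict Ω) ∧ MemLp G p (volume.restrict Ω) ∧
    ∀ ε : ℝ≥0∞, 0 < ε → ∃ η : E → ℝ, IsTestFunctionOn Ω η ∧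
      eLpNorm (fun x => u x - η x) p (volume.restrict Ω) < ε ∧
      eLpNorm (fun x => G x - fderiv ℝ η x) p (volume.restrict Ω) < ε

/-- `φ ∈ W^{1,1}_loc(Ω)` is `α`-almost weakly monotone in the open set `Ω`, where `α > 0`. A ball
is compactly contained in `Ω` when the corresponding closed ball is a subset of `Ω`. -/
def IsAlmostWeaklyMonotone {E : Type*} [NormedAddCommGroup E] [NormedSpace ℝ E] [MeasureSpace E]
    (α : ℝ) (Ω : Set E) (φ : E → ℝ) : Prop :=
  0 < α ∧ MemW1Loc Ω 1 φ ∧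
    ∃ C : ℝ, 0 < C ∧
      ∀ (x₀ : E) (r : ℝ), 0 < r → closedBall x₀ r ⊆ Ω →
        ∀ M m : ℝ,
          MemW1Zero (ball x₀ r) 1 (fun x => max (φ x - M) 0) →
          MemW1Zero (ball x₀ r) 1 (fun x => max (m - φ x) 0) →
            eLpNorm (fun x => max (φ x - M) 0) ∞ (volume.restrict (ball x₀ r))
                ≤ ENNReal.ofReal (C * r ^ α) ∧
            eLpNorm (fun x => max (m - φ x) 0) ∞ (volume.restrict (ball x₀ r))
                ≤ ENNReal.ofReal (C * r ^ α)

open scoped Convolution Topology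
open Filter ContinuousLinearMap

/-! The plan is to find, around each point, spheres on which `φ` is nearly constant, and to let
almost monotonicity carry this bound into the ball. Write `d` for the dimension and `G` for the weak
gradient.

Morrey's argument joins a point `x` of the sphere of radius `r` around `x₀` to the points `y` of
`ball x₀ R`, where `R < r < 2R`. Hölder's inequality and a homothety bound the distance from `v x`
to the mean of a smooth `v` by an integral over `0 < t ≤ 1` of `t⁻¹` times the `L^d` norm of the
gradient on the region swept at time `t`. With the whole ball as region this diverges
logarithmically, as it must for the critical exponent `d`. But the region lies in a shell of width
comparable to `R t` around the sphere, and averaging over `r` gains a factor `t^(1/d)`, which makes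
the integral converge (`lintegral_sphereOscBound_le`). The bound depends on `x` only through `r`, so
a good radius controls a whole sphere by the `d`-energy. Fatou's lemma gives one radius that serves
infinitely many mollifications of `φ` (`exists_radius_frequently_enorm_sub_average_lt`).

If the mollifications are at most `M` on that sphere, smooth truncations of them are test functions
and show that `(φ - M)⁺` has zero trace (`memW1Zero_posPart_of_tendsto`); likewise from below.
Almost monotonicity then bounds `|φ - c|` on `ball x₀ R` by the energy term plus `C (2R)^α`
(`exists_ae_abs_sub_le`). Both tend to zero with `R`: the energy by absolute continuity of the
integral of `|G|^d`, the other because `α > 0`. Vanishing essential oscillation at every point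
yields the continuous representative (`exists_continuousOn_ae_eq_of_small_oscillation`). -/

/-- Jensen's inequality for the power function and a weight of total mass one. -/
theorem rpow_lintegral_mul_le {β : Type*} [MeasurableSpace β] {μ : Measure β}
    {w h : β → ℝ≥0∞} (hw : Measurable w) (hw1 : ∫⁻ y, w y ∂μ = 1) (hh : AEMeasurable h μ)
    {p : ℝ} (hp : 1 ≤ p) :
    (∫⁻ y, w y * h y ∂μ) ^ p ≤ ∫⁻ y, w y * h y ^ p ∂μ := by
  have hp0 : 0 < p := by linarith
  have : IsProbabilityMeasure (μ.withDensity w) := ⟨by simp [hw1]⟩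
  have hac : μ.withDensity w ≪ μ := withDensity_absolutelyContinuous _ _
  have key := eLpNorm'_le_eLpNorm'_of_exponent_le one_pos hp (μ.withDensity w)
    (hh.mono_ac hac).aestronglyMeasurable
  simp only [eLpNorm', enorm_eq_self, ENNReal.rpow_one, div_one] at key
  rw [one_div, ENNReal.le_rpow_inv_iff hp0,
    lintegral_withDensity_eq_lintegral_mul₀ hw.aemeasurable hh,
    lintegral_withDensity_eq_lintegral_mul₀ hw.aemeasurable (hh.pow_const p)] at key
  exact key

/-! ### Mollification: contraction, convergence and weak derivatives -/

section Mollification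

set_option linter.unusedSectionVars false

variable {E : Type*} [NormedAddCommGroup E] [NormedSpace ℝ E] [FiniteDimensional ℝ E]
  [MeasureSpace E] [BorelSpace E] [(volume : Measure E).IsAddHaarMeasure]
  {F : Type*} [NormedAddCommGroup F] [NormedSpace ℝ F]

/-- The convolution of `f` with the normalized bump function `ρ`. -/
noncomputable def mollify (ρ : ContDiffBump (0 : E)) (f : E → F) : E → F :=
  ρ.normed volume ⋆[lsmul ℝ ℝ, volume] f

theorem mollify_apply (ρ : ContDiffBump (0 : E)) (f : E → F) (x : E) :
    mollify ρ f x = ∫ y, ρ.normed volume y • f (x - y) := rfl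

theorem mollify_eq_swap (ρ : ContDiffBump (0 : E)) (f : E → F) (x : E) :
    mollify ρ f x = ∫ y, ρ.normed volume (x - y) • f y := by
  rw [mollify, convolution_eq_swap]; rfl

/-- The normalized bump is a probability density, so Jensen applies pointwise; Tonelli and
translation invariance finish. This gives an energy bound uniform in the mollification parameter. -/
theorem lintegral_mollify_rpow_le (ρ : ContDiffBump (0 : E)) {f : E → F}
    (hf : AEStronglyMeasurable f volume) {p : ℝ} (hp : 1 ≤ p) :
    ∫⁻ x, ‖mollify ρ f x‖ₑ ^ p ≤ ∫⁻ x, ‖f x‖ₑ ^ p := by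
  set w : E → ℝ≥0∞ := fun y => ‖ρ.normed volume y‖ₑ with hw
  have hwm : Measurable w := ρ.continuous_normed.enorm.measurable
  have hw1 : ∫⁻ y, w y = 1 := by
    have : ∀ y, w y = ENNReal.ofReal (ρ.normed volume y) := fun y =>
      Real.enorm_of_nonneg (ρ.nonneg_normed y)
    simp_rw [this]
    rw [← ofReal_integral_eq_lintegral_ofReal ρ.integrable_normed
      (ae_of_all _ ρ.nonneg_normed), ρ.integral_normed, ENNReal.ofReal_one]
  have hsub : AEStronglyMeasurable (fun z : E × E => f (z.1 - z.2)) (volume.prod volume) :=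
    hf.comp_quasiMeasurePreserving (quasiMeasurePreserving_sub volume volume)
  have hx : ∀ x, AEMeasurable (fun y => ‖f (x - y)‖ₑ) volume := fun x =>
    (hf.comp_quasiMeasurePreserving
      (quasiMeasurePreserving_sub_left volume x)).enorm
  calc ∫⁻ x, ‖mollify ρ f x‖ₑ ^ p
      ≤ ∫⁻ x, ∫⁻ y, w y * ‖f (x - y)‖ₑ ^ p := by
        refine lintegral_mono fun x => ?_
        refine le_trans ?_ (rpow_lintegral_mul_le hwm hw1 (hx x) hp)
        gcongr
        rw [mollify_apply]
        refine (enorm_integral_le_lintegral_enorm _).trans (le_of_eq ?_)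
        simp_rw [enorm_smul, hw]
    _ = ∫⁻ y, ∫⁻ x, w y * ‖f (x - y)‖ₑ ^ p := by
        refine lintegral_lintegral_swap ?_
        exact (hwm.comp measurable_snd).aemeasurable.mul (hsub.enorm.pow_const p)
    _ = ∫⁻ y, w y * ∫⁻ x, ‖f x‖ₑ ^ p := by
        refine lintegral_congr fun y => ?_
        rw [lintegral_const_mul' _ _ enorm_ne_top]
        congr 1
        exact lintegral_sub_right_eq_self (fun x => ‖f x‖ₑ ^ p) y
    _ = ∫⁻ x, ‖f x‖ₑ ^ p := by
        rw [lintegral_mul_const _ hwm, hw1, one_mul]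

theorem contDiff_mollify [CompleteSpace F] (ρ : ContDiffBump (0 : E)) {f : E → F}
    (hf : LocallyIntegrable f volume) : ContDiff ℝ ∞ (mollify ρ f) :=
  ρ.hasCompactSupport_normed.contDiff_convolution_left _ ρ.contDiff_normed hf

theorem mollify_sub (ρ : ContDiffBump (0 : E)) {f g : E → F}
    (hf : LocallyIntegrable f volume) (hg : LocallyIntegrable g volume) :
    mollify ρ (f - g) = mollify ρ f - mollify ρ g := by
  ext x
  have h : ∀ {u : E → F}, LocallyIntegrable u volume →
      Integrable (fun y => ρ.normed volume y • u (x - y)) volume := fun hu =>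
    ρ.hasCompactSupport_normed.convolutionExists_left (lsmul ℝ ℝ) ρ.continuous_normed hu x
  simp only [mollify_apply, Pi.sub_apply, smul_sub]
  exact integral_sub (h hf) (h hg)

/-- Mollifications of an integrable function converge to it in `L¹` on sets of finite measure. -/
theorem tendsto_lintegral_mollify_sub [CompleteSpace F] {ρ : ℕ → ContDiffBump (0 : E)}
    (hρ : Tendsto (fun k => (ρ k).rOut) atTop (𝓝 0)) {f : E → F} (hf : Integrable f volume)
    {s : Set E} (hs : volume s ≠ ⊤) :
    Tendsto (fun k => ∫⁻ x in s, ‖mollify (ρ k) f x - f x‖ₑ) atTop (𝓝 0) := by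
  rw [ENNReal.tendsto_nhds_zero]
  intro ε hε
  by_cases hεt : ε = ⊤
  · simp [hεt]
  have hε3 : ε / 3 ≠ 0 := (ENNReal.div_pos hε.ne' (by simp)).ne'
  -- Three errors of `ε / 3`: mollification contracts `f - g` in `L¹`, the uniformly continuous `g`
  -- is uniformly close to its mollification on `s`, and `g` is close to `f`.
  obtain ⟨g, hgc, hfg, hg, hgL⟩ := (memLp_one_iff_integrable.2 hf).exists_hasCompactSupport_eLpNorm_sub_le
    ENNReal.one_ne_top hε3
  rw [eLpNorm_one_eq_lintegral_enorm] at hfg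
  have hgi : Integrable g volume := memLp_one_iff_integrable.1 hgL
  obtain ⟨δ, hδ, hδs⟩ : ∃ δ : ℝ, 0 < δ ∧ ENNReal.ofReal δ * volume s ≤ ε / 3 := by
    have h1 : Tendsto (fun δ : ℝ => ENNReal.ofReal δ * volume s) (𝓝[>] 0) (𝓝 0) := by
      have h2 : Tendsto (fun δ : ℝ => ENNReal.ofReal δ) (𝓝[>] 0) (𝓝 0) := by
        have := (ENNReal.continuous_ofReal.tendsto (0 : ℝ)).mono_left
          (nhdsWithin_le_nhds (s := Ioi 0))
        simpa using this
      simpa using ENNReal.Tendsto.mul_const h2 (Or.inr hs)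
    obtain ⟨δ, h, h'⟩ := ((ENNReal.tendsto_nhds_zero.1 h1 _ (pos_iff_ne_zero.2 hε3)).and
      self_mem_nhdsWithin).exists
    exact ⟨δ, h', h⟩
  obtain ⟨η, hη, hη'⟩ := Metric.uniformContinuous_iff.1
    (hg.uniformContinuous_of_tendsto_cocompact hgc.is_zero_at_infty) δ hδ
  filter_upwards [hρ.eventually (gt_mem_nhds hη)] with k hk
  have h1 : ∫⁻ x in s, ‖mollify (ρ k) f x - mollify (ρ k) g x‖ₑ ≤ ε / 3 := by
    have := lintegral_mollify_rpow_le (ρ k) (hf.sub hgi).aestronglyMeasurable le_rfl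
    simp only [ENNReal.rpow_one, mollify_sub (ρ k) hf.locallyIntegrable hgi.locallyIntegrable]
      at this
    exact (setLIntegral_le_lintegral _ _).trans (this.trans hfg)
  have h2 : ∫⁻ x in s, ‖mollify (ρ k) g x - g x‖ₑ ≤ ε / 3 := by
    refine le_trans (lintegral_mono (g := fun _ => ENNReal.ofReal δ) fun x => ?_) ?_
    · rw [← edist_eq_enorm_sub, edist_dist]
      refine ENNReal.ofReal_le_ofReal (ContDiffBump.dist_normed_convolution_le
        hg.aestronglyMeasurable fun y hy => (hη' ((mem_ball.1 hy).trans hk)).le)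
    · simpa using hδs
  have h3 : ∫⁻ x in s, ‖g x - f x‖ₑ ≤ ε / 3 := by
    refine (setLIntegral_le_lintegral _ _).trans (le_trans (le_of_eq ?_) hfg)
    refine lintegral_congr fun x => ?_
    rw [Pi.sub_apply, ← enorm_neg, neg_sub]
  have hcf := (contDiff_mollify (ρ k) hf.locallyIntegrable).continuous
  have hcg := (contDiff_mollify (ρ k) hgi.locallyIntegrable).continuous
  calc ∫⁻ x in s, ‖mollify (ρ k) f x - f x‖ₑ
      ≤ ∫⁻ x in s, (‖mollify (ρ k) f x - mollify (ρ k) g x‖ₑ + (‖mollify (ρ k) g x - g x‖ₑ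
          + ‖g x - f x‖ₑ)) := by
        refine lintegral_mono fun x => ?_
        have : mollify (ρ k) f x - f x = (mollify (ρ k) f x - mollify (ρ k) g x) +
          ((mollify (ρ k) g x - g x) + (g x - f x)) := by abel
        rw [this]
        exact (enorm_add_le _ _).trans (by gcongr; exact enorm_add_le _ _)
    _ ≤ ε / 3 + (ε / 3 + ε / 3) := by
        rw [lintegral_add_left (by exact (hcf.sub hcg).enorm.measurable),
          lintegral_add_left (by exact (hcg.sub hg).enorm.measurable)]
        gcongr
    _ = ε := by rw [← add_assoc, ENNReal.add_thirds]

/-- Mollification commutes with weak differentiation away from the boundary. -/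
theorem fderiv_mollify_indicator {U : Set E} (hU : MeasurableSet U) {u : E → ℝ}
    {G : E → E →L[ℝ] ℝ} (h : HasWeakDerivOn U u G) (hu : IntegrableOn u U)
    (hG : IntegrableOn G U) (ρ : ContDiffBump (0 : E)) {x : E} (hx : closedBall x ρ.rOut ⊆ U) :
    fderiv ℝ (mollify ρ (U.indicator u)) x = mollify ρ (U.indicator G) x := by
  have hui : Integrable (U.indicator u) volume := (integrable_indicator_iff hU).2 hu
  have hGi : Integrable (U.indicator G) volume :=
    (integrable_indicator_iff (ε' := E →L[ℝ] ℝ) (f := G) hU).2 hG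
  have hd := (ρ.hasCompactSupport_normed (μ := volume)).hasFDerivAt_convolution_left (lsmul ℝ ℝ)
    ρ.contDiff_normed hui.locallyIntegrable x
  have hcomp : HasCompactSupport (fderiv ℝ (ρ.normed volume)) :=
    ρ.hasCompactSupport_normed.fderiv ℝ
  have hcont : Continuous (fderiv ℝ (ρ.normed (volume : Measure E))) :=
    (ρ.contDiff_normed (n := 1)).continuous_fderiv one_ne_zero
  refine hd.fderiv.trans ?_
  ext v
  -- The reflected kernel is an admissible test function because the closed ball around `x` lies in
  -- `U`; reflection accounts for the sign in the weak derivative identity.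
  set η : E → ℝ := fun y => ρ.normed volume (x - y) with hη
  have hηt : IsTestFunctionOn U η := by
    have hts : tsupport η ⊆ closedBall x ρ.rOut := by
      refine closure_minimal (fun y hy => ?_) isClosed_closedBall
      have : x - y ∈ Function.support (ρ.normed (volume : Measure E)) := hy
      rw [ρ.support_normed_eq, mem_ball_zero_iff] at this
      rw [mem_closedBall, dist_eq_norm, ← norm_neg, neg_sub]
      exact this.le
    exact ⟨ρ.contDiff_normed.comp (contDiff_const.sub contDiff_id),
      HasCompactSupport.of_support_subset_isCompact (isCompact_closedBall x ρ.rOut)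
        ((subset_tsupport _).trans hts), hts.trans hx⟩
  have hηd : ∀ y, fderiv ℝ η y v = - fderiv ℝ (ρ.normed volume) (x - y) v := by
    intro y
    have h1 : HasFDerivAt η ((fderiv ℝ (ρ.normed volume) (x - y)).comp
        (-(ContinuousLinearMap.id ℝ E))) y :=
      HasFDerivAt.comp y ((ρ.contDiff_normed (n := 1)).differentiable one_ne_zero _).hasFDerivAt
        ((hasFDerivAt_id y).const_sub x)
    rw [h1.fderiv]; simp
  have e1 : (fderiv ℝ (ρ.normed volume) ⋆[precompL E (lsmul ℝ ℝ), volume] U.indicator u) x v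
      = ∫ y, fderiv ℝ (ρ.normed volume) (x - y) v * U.indicator u y := by
    rw [convolution_eq_swap, ContinuousLinearMap.integral_apply]
    · rfl
    · exact convolutionExistsAt_iff_integrable_swap.1
        (hcomp.convolutionExists_left _ hcont hui.locallyIntegrable x)
  have e2 : mollify ρ (U.indicator G) x v
      = ∫ y, ρ.normed volume (x - y) * U.indicator G y v := by
    rw [mollify_eq_swap, ContinuousLinearMap.integral_apply]
    · rfl
    · exact convolutionExistsAt_iff_integrable_swap.1
        (ρ.hasCompactSupport_normed.convolutionExists_left (lsmul ℝ ℝ) ρ.continuous_normed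
          hGi.locallyIntegrable x)
  have hw := h.2.2 η hηt v
  rw [e1, e2, ← neg_inj]
  calc _ = ∫ y in U, u y * fderiv ℝ η y v := by
        rw [← integral_indicator hU, ← integral_neg]
        refine integral_congr_ae (ae_of_all _ fun y => ?_)
        by_cases hy : y ∈ U <;> simp [hy, hηd, mul_comm]
    _ = _ := by
        rw [hw, ← integral_indicator hU]
        congr 1
        refine integral_congr_ae (ae_of_all _ fun y => ?_)
        by_cases hy : y ∈ U <;> simp [hy, hη, mul_comm]

end Mollification

/-- Hölder's inequality against the constant one. It serves twice: over the ball in `y`, and over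
the interval of radii. -/
theorem lintegral_le_rpow_lintegral_rpow_mul {β : Type*} [MeasurableSpace β] {μ : Measure β}
    {h : β → ℝ≥0∞} (hh : AEMeasurable h μ) {p : ℝ} (hp : 1 ≤ p) :
    ∫⁻ y, h y ∂μ ≤ (∫⁻ y, h y ^ p ∂μ) ^ p⁻¹ * μ univ ^ (1 - p⁻¹) := by
  have key := eLpNorm'_le_eLpNorm'_mul_rpow_measure_univ one_pos hp hh.aestronglyMeasurable
  simpa only [eLpNorm', enorm_eq_self, ENNReal.rpow_one, div_one, one_div] using key

/-! ### Oscillation on spheres at the critical exponent -/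

section SphereEstimate

set_option linter.unusedSectionVars false

variable {E : Type*} [NormedAddCommGroup E] [NormedSpace ℝ E] [FiniteDimensional ℝ E]
  [MeasureSpace E] [BorelSpace E] [(volume : Measure E).IsAddHaarMeasure]

/-- The Jacobian factor `t^(-d)` becomes the `t⁻¹` of `sphereOscBound` after taking `d`-th roots. -/
theorem lintegral_comp_homothety (x : E) {t : ℝ} (ht : 0 < t) {f : E → ℝ≥0∞}
    (hf : Measurable f) :
    ∫⁻ y, f (x + t • (y - x)) =
      ENNReal.ofReal t⁻¹ ^ Module.finrank ℝ E * ∫⁻ z, f z := by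
  have h1 : ∫⁻ y, f (x + t • (y - x)) = ∫⁻ y, f (x + t • y) :=
    lintegral_sub_right_eq_self (fun y => f (x + t • y)) x
  have h2 : ∫⁻ y, f (x + t • y) =
      ∫⁻ z, f (x + z) ∂(Measure.map (fun y : E => t • y) volume) := by
    rw [lintegral_map (by fun_prop) (by fun_prop)]
  have h3 : Measure.map (fun y : E => t • y) volume = _ :=
    Measure.map_addHaar_smul (volume : Measure E) ht.ne'
  rw [h1, h2, h3, lintegral_smul_measure, smul_eq_mul, lintegral_add_left_eq_self,
    ← inv_pow, abs_of_pos (by positivity), ENNReal.ofReal_pow (by positivity)]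

/-- The part of `ball x₀ (2 * R)` whose distance to the sphere of radius `r` is at most `3Rt`. -/
def ballShell (x₀ : E) (R r t : ℝ) : Set E :=
  ball x₀ (2 * R) ∩ {z | |dist z x₀ - r| ≤ 3 * R * t}

theorem measurableSet_ballShell (x₀ : E) (R r t : ℝ) : MeasurableSet (ballShell x₀ R r t) :=
  measurableSet_ball.inter (isClosed_le (by fun_prop) continuous_const).measurableSet

/-- The bound for the oscillation on the sphere of radius `r` around `x₀` of a function whose
gradient has `d`-th power `h`. -/
noncomputable def sphereOscBound (h : E → ℝ≥0∞) (x₀ : E) (R r : ℝ) : ℝ≥0∞ :=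
  ∫⁻ t in Ioc (0 : ℝ) 1, ENNReal.ofReal t⁻¹ *
    (∫⁻ z in ballShell x₀ R r t, h z) ^ (Module.finrank ℝ E : ℝ)⁻¹

/-- At time `t` a point starting at `x` has moved by `t |y - x| ≤ 3Rt`, since `|x - x₀| < 2R` and
`|y - x₀| < R`. This localization near the sphere is what improves on the plain Morrey bound. -/
theorem homothety_mem_ballShell {x₀ x y : E} {R t : ℝ} (hx : dist x x₀ < 2 * R)
    (hy : y ∈ ball x₀ R) (ht : t ∈ Ioc (0 : ℝ) 1) :
    x + t • (y - x) ∈ ballShell x₀ R (dist x x₀) t := by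
  have hR : 0 < R := pos_of_mem_ball hy
  constructor
  · have hy' : y ∈ ball x₀ (2 * R) := ball_subset_ball (by linarith) hy
    exact (convex_ball x₀ (2 * R)).add_smul_sub_mem hx hy' ⟨ht.1.le, ht.2⟩
  · have h1 : |dist (x + t • (y - x)) x₀ - dist x x₀| ≤ dist (x + t • (y - x)) x :=
      abs_dist_sub_le _ _ _
    have h2 : dist (x + t • (y - x)) x = t * dist y x := by
      rw [dist_eq_norm, add_sub_cancel_left, norm_smul, Real.norm_of_nonneg ht.1.le, dist_eq_norm]
    have h3 : dist y x ≤ 3 * R := by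
      have := dist_triangle_right y x x₀
      have := mem_ball.1 hy
      linarith
    have := mul_le_mul_of_nonneg_left h3 ht.1.le
    simp only [mem_ofPred_eq]
    linarith

theorem enorm_sub_le_lintegral_segment {v : E → ℝ} (hv : ContDiff ℝ 1 v) (x y : E) :
    ‖v y - v x‖ₑ ≤ ∫⁻ t in Ioc (0 : ℝ) 1, ‖fderiv ℝ v (x + t • (y - x))‖ₑ * ‖y - x‖ₑ := by
  have hg : ContDiff ℝ 1 (fun t : ℝ => v (x + t • (y - x))) := by fun_prop
  have key := enorm_sub_le_lintegral_deriv_of_contDiffOn_Icc (hg.contDiffOn (s := Icc 0 1))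
    zero_le_one
  simp only [one_smul, add_sub_cancel, zero_smul, add_zero] at key
  rw [restrict_Ioc_eq_restrict_Icc]
  refine key.trans (lintegral_mono fun t => ?_)
  have h1 : HasDerivAt (fun t : ℝ => x + t • (y - x)) (y - x) t := by
    simpa using ((hasDerivAt_id t).smul_const (y - x)).const_add x
  have h2 := ((hv.differentiable one_ne_zero (x + t • (y - x))).hasFDerivAt).comp_hasDerivAt t h1
  have h3 : deriv (fun t : ℝ => v (x + t • (y - x))) t = fderiv ℝ v (x + t • (y - x)) (y - x) :=
    h2.deriv
  rw [h3]
  exact ContinuousLinearMap.le_opENorm _ _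

/-- A Morrey type estimate, on a sphere, with the critical exponent. -/
theorem enorm_sub_average_le [Nontrivial E] {v : E → ℝ} (hv : ContDiff ℝ 1 v) {x₀ x : E} {R : ℝ}
    (hR : 0 < R) (hx : dist x x₀ < 2 * R) :
    ‖v x - ⨍ y in ball x₀ R, v y‖ₑ ≤
      ENNReal.ofReal (3 * R) * volume (ball x₀ R) ^ (-(Module.finrank ℝ E : ℝ)⁻¹) *
        sphereOscBound (fun z => ‖fderiv ℝ v z‖ₑ ^ (Module.finrank ℝ E : ℝ)) x₀ R (dist x x₀) := by
  set d : ℝ := (Module.finrank ℝ E : ℝ) with hd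
  have hd1 : 1 ≤ d := by
    rw [hd]; exact_mod_cast Module.finrank_pos
  have hd0 : 0 < d := by linarith
  set V := volume (ball x₀ R) with hV
  have hV0 : V ≠ 0 := (measure_ball_pos volume x₀ hR).ne'
  have hVt : V ≠ ⊤ := measure_ball_lt_top.ne
  have hfd : Continuous (fderiv ℝ v) := hv.continuous_fderiv one_ne_zero
  have hvc : Continuous v := hv.continuous
  have hvi : IntegrableOn v (ball x₀ R) :=
    (hvc.continuousOn.integrableOn_compact (isCompact_closedBall x₀ R)).mono_set
      ball_subset_closedBall
  have step1 : ‖v x - ⨍ y in ball x₀ R, v y‖ₑ ≤ V⁻¹ * ∫⁻ y in ball x₀ R, ‖v y - v x‖ₑ := by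
    have h1 : ⨍ y in ball x₀ R, (v y - v x) = (⨍ y in ball x₀ R, v y) - v x := by
      rw [average_eq, average_eq, integral_sub hvi (integrableOn_const hVt)]
      simp only [integral_const, smul_eq_mul, mul_sub, measureReal_restrict_apply_univ]
      have : volume.real (ball x₀ R) ≠ 0 := by
        rw [Measure.real, ENNReal.toReal_ne_zero]; exact ⟨hV0, hVt⟩
      field_simp
    rw [← enorm_neg, neg_sub, ← h1, average_eq, enorm_smul]
    refine mul_le_mul' (le_of_eq ?_) (enorm_integral_le_lintegral_enorm _)
    rw [measureReal_restrict_apply_univ, Measure.real, ← ENNReal.toReal_inv,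
      Real.enorm_of_nonneg ENNReal.toReal_nonneg, ENNReal.ofReal_toReal (ENNReal.inv_ne_top.2 hV0)]
  have step2 : ∫⁻ y in ball x₀ R, ‖v y - v x‖ₑ ≤
      ENNReal.ofReal (3 * R) * ∫⁻ t in Ioc (0 : ℝ) 1, ∫⁻ y in ball x₀ R,
        ‖fderiv ℝ v (x + t • (y - x))‖ₑ := by
    calc ∫⁻ y in ball x₀ R, ‖v y - v x‖ₑ
        ≤ ∫⁻ y in ball x₀ R, ∫⁻ t in Ioc (0 : ℝ) 1, ENNReal.ofReal (3 * R) *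
            ‖fderiv ℝ v (x + t • (y - x))‖ₑ := by
          refine setLIntegral_mono' measurableSet_ball fun y hy => ?_
          refine (enorm_sub_le_lintegral_segment hv x y).trans (lintegral_mono fun t => ?_)
          simp only
          rw [mul_comm]
          gcongr
          rw [← edist_eq_enorm_sub, edist_dist]
          refine ENNReal.ofReal_le_ofReal ?_
          have := dist_triangle_right y x x₀
          have := mem_ball.1 hy
          linarith
      _ = _ := by
          rw [lintegral_lintegral_swap (by
            refine Continuous.aemeasurable ?_
            refine ENNReal.continuous_const_mul ENNReal.ofReal_ne_top |>.comp ?_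
            exact continuous_enorm.comp (hfd.comp (by fun_prop)))]
          rw [← lintegral_const_mul' _ _ ENNReal.ofReal_ne_top]
          refine lintegral_congr fun t => ?_
          rw [lintegral_const_mul' _ _ ENNReal.ofReal_ne_top]
  -- Hölder in `y` produces `V ^ (1 - d⁻¹)`; the substitution `z = x + t (y - x)` maps the ball into
  -- the shell.
  have step3 : ∀ t ∈ Ioc (0 : ℝ) 1, ∫⁻ y in ball x₀ R, ‖fderiv ℝ v (x + t • (y - x))‖ₑ ≤
      V ^ (1 - d⁻¹) * (ENNReal.ofReal t⁻¹ *
        (∫⁻ z in ballShell x₀ R (dist x x₀) t, ‖fderiv ℝ v z‖ₑ ^ d) ^ d⁻¹) := by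
    intro t ht
    have hmeas : Measurable fun z => ‖fderiv ℝ v z‖ₑ ^ d := hfd.enorm.measurable.pow_const d
    have h1 := lintegral_le_rpow_lintegral_rpow_mul (μ := volume.restrict (ball x₀ R))
      (h := fun y => ‖fderiv ℝ v (x + t • (y - x))‖ₑ)
      (continuous_enorm.comp (hfd.comp (by fun_prop))).aemeasurable hd1
    rw [Measure.restrict_apply_univ] at h1
    refine h1.trans ?_
    rw [mul_comm]
    gcongr
    have h2 : ∫⁻ y in ball x₀ R, ‖fderiv ℝ v (x + t • (y - x))‖ₑ ^ d ≤
        ENNReal.ofReal t⁻¹ ^ d *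
          ∫⁻ z in ballShell x₀ R (dist x x₀) t, ‖fderiv ℝ v z‖ₑ ^ d := by
      rw [← lintegral_indicator (measurableSet_ballShell _ _ _ _), hd, ENNReal.rpow_natCast,
        ← lintegral_comp_homothety x ht.1 (by
          exact hmeas.indicator (measurableSet_ballShell x₀ R (dist x x₀) t)),
        ← lintegral_indicator measurableSet_ball]
      refine lintegral_mono fun y => ?_
      by_cases hy : y ∈ ball x₀ R
      · rw [indicator_of_mem hy, indicator_of_mem (homothety_mem_ballShell hx hy ht)]
      · rw [indicator_of_notMem hy]; exact zero_le
    refine (ENNReal.rpow_le_rpow h2 (by positivity)).trans (le_of_eq ?_)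
    rw [ENNReal.mul_rpow_of_nonneg _ _ (by positivity), ENNReal.rpow_rpow_inv hd0.ne']
  calc ‖v x - ⨍ y in ball x₀ R, v y‖ₑ
      ≤ V⁻¹ * (ENNReal.ofReal (3 * R) * (V ^ (1 - d⁻¹) *
          sphereOscBound (fun z => ‖fderiv ℝ v z‖ₑ ^ d) x₀ R (dist x x₀))) := by
        refine step1.trans ?_
        gcongr
        refine step2.trans ?_
        gcongr
        rw [sphereOscBound, ← lintegral_const_mul' _ _
          (ENNReal.rpow_ne_top_of_nonneg (by simpa using inv_le_one_of_one_le₀ hd1) hVt)]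
        exact setLIntegral_mono' measurableSet_Ioc step3
    _ = _ := by
        have : V ^ (-d⁻¹) = V⁻¹ * V ^ (1 - d⁻¹) := by
          rw [sub_eq_add_neg, ENNReal.rpow_add _ _ hV0 hVt, ENNReal.rpow_one, ← mul_assoc,
            ENNReal.inv_mul_cancel hV0 hVt, one_mul]
        rw [this]; ring

theorem measurable_lintegral_ballShell {h : E → ℝ≥0∞} (hh : Measurable h) (x₀ : E) (R : ℝ) :
    Measurable fun q : ℝ × ℝ => ∫⁻ z in ballShell x₀ R q.1 q.2, h z := by
  have hS : MeasurableSet {w : (ℝ × ℝ) × E | w.2 ∈ ballShell x₀ R w.1.1 w.1.2} := by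
    refine (isOpen_ball.preimage continuous_snd).measurableSet.inter
      (IsClosed.measurableSet (isClosed_le ?_ ?_)) <;> fun_prop
  have : (fun q : ℝ × ℝ => ∫⁻ z in ballShell x₀ R q.1 q.2, h z) = fun q => ∫⁻ z,
      ({w : (ℝ × ℝ) × E | w.2 ∈ ballShell x₀ R w.1.1 w.1.2}.indicator
        (fun w => h w.2)) (q, z) := by
    ext q
    rw [← lintegral_indicator (measurableSet_ballShell _ _ _ _)]
    rfl
  rw [this]
  exact ((hh.comp measurable_snd).indicator hS).lintegral_prod_right'

theorem measurable_sphereOscBound_integrand {h : E → ℝ≥0∞} (hh : Measurable h) (x₀ : E) (R : ℝ) :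
    Measurable fun q : ℝ × ℝ => ENNReal.ofReal q.2⁻¹ *
      (∫⁻ z in ballShell x₀ R q.1 q.2, h z) ^ (Module.finrank ℝ E : ℝ)⁻¹ :=
  (ENNReal.measurable_ofReal.comp measurable_snd.inv).mul
    ((measurable_lintegral_ballShell hh x₀ R).pow_const _)

theorem measurable_sphereOscBound {h : E → ℝ≥0∞} (hh : Measurable h) (x₀ : E) (R : ℝ) :
    Measurable (sphereOscBound h x₀ R) :=
  (measurable_sphereOscBound_integrand hh x₀ R).lintegral_prod_right'

/-- By Tonelli: a fixed `z` lies in the shell only for `r` in an interval of length `6Rt`. -/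
theorem lintegral_lintegral_ballShell_le {h : E → ℝ≥0∞} (hh : Measurable h) (x₀ : E) (R t : ℝ)
    (s : Set ℝ) :
    ∫⁻ r in s, ∫⁻ z in ballShell x₀ R r t, h z ≤
      ENNReal.ofReal (6 * R * t) * ∫⁻ z in ball x₀ (2 * R), h z := by
  have hS : MeasurableSet {w : ℝ × E | |dist w.2 x₀ - w.1| ≤ 3 * R * t} :=
    IsClosed.measurableSet (isClosed_le (by fun_prop) (by fun_prop))
  calc ∫⁻ r in s, ∫⁻ z in ballShell x₀ R r t, h z
      ≤ ∫⁻ r, ∫⁻ z in ballShell x₀ R r t, h z := setLIntegral_le_lintegral _ _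
    _ = ∫⁻ r, ∫⁻ z in ball x₀ (2 * R),
          {w : ℝ × E | |dist w.2 x₀ - w.1| ≤ 3 * R * t}.indicator (fun w => h w.2) (r, z) := by
        refine lintegral_congr fun r => ?_
        have hm : MeasurableSet {z : E | |dist z x₀ - r| ≤ 3 * R * t} :=
          IsClosed.measurableSet (isClosed_le (by fun_prop) (by fun_prop))
        rw [ballShell, inter_comm, ← Measure.restrict_restrict hm, ← lintegral_indicator hm]
        rfl
    _ = ∫⁻ z in ball x₀ (2 * R), ∫⁻ r,
          {w : ℝ × E | |dist w.2 x₀ - w.1| ≤ 3 * R * t}.indicator (fun w => h w.2) (r, z) :=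
        lintegral_lintegral_swap ((hh.comp measurable_snd).indicator hS).aemeasurable
    _ = ∫⁻ z in ball x₀ (2 * R), ENNReal.ofReal (6 * R * t) * h z := by
        refine lintegral_congr fun z => ?_
        have : (fun r => {w : ℝ × E | |dist w.2 x₀ - w.1| ≤ 3 * R * t}.indicator
            (fun w => h w.2) (r, z)) =
            (closedBall (dist z x₀) (3 * R * t)).indicator (fun _ => h z) := by
          ext r
          simp only [indicator, mem_ofPred_eq, mem_closedBall, Real.dist_eq, abs_sub_comm r]
        rw [this, lintegral_indicator measurableSet_closedBall, setLIntegral_const,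
          Real.volume_closedBall, mul_comm]
        congr 2; ring
    _ = _ := lintegral_const_mul' _ _ ENNReal.ofReal_ne_top

/-- A constant that depends only on the dimension. -/
noncomputable def radialConst (d : ℝ) : ℝ≥0∞ :=
  ∫⁻ t in Ioc (0 : ℝ) 1, ENNReal.ofReal t⁻¹ * ENNReal.ofReal (6 * t) ^ d⁻¹

/-- The integrand is a multiple of `t^(-1 + 1/d)`, with exponent above `-1`. Without the factor
gained by averaging over radii it would be `t⁻¹`. -/
theorem radialConst_ne_top {d : ℝ} (hd : 0 < d) : radialConst d ≠ ⊤ := by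
  have hint : IntegrableOn (fun t : ℝ => (6 : ℝ) ^ d⁻¹ * t ^ (-1 + d⁻¹)) (Ioc 0 1) := by
    have := intervalIntegral.intervalIntegrable_rpow' (a := 0) (b := 1) (r := -1 + d⁻¹)
      (by have := inv_pos.2 hd; linarith)
    exact ((intervalIntegrable_iff_integrableOn_Ioc_of_le zero_le_one).1 this).const_mul _
  have hfin := hint.lintegral_lt_top
  refine (lt_of_le_of_lt (setLIntegral_mono' measurableSet_Ioc fun t ht => ?_) hfin).ne
  rw [ENNReal.ofReal_rpow_of_nonneg (by linarith [ht.1]) (by positivity),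
    ← ENNReal.ofReal_mul (by have := ht.1; positivity)]
  refine ENNReal.ofReal_le_ofReal (le_of_eq ?_)
  rw [Real.mul_rpow (by norm_num) ht.1.le, Real.rpow_add ht.1, Real.rpow_neg_one]
  ring

/-- After exchanging `r` and `t`, Hölder in `r` brings the integral inside the power `1/d`, where
the shell bound applies. The powers of `R` combine to `R`, the length of the interval of radii, so
the mean over radii has a bound free of scale. -/
theorem lintegral_sphereOscBound_le [Nontrivial E] {h : E → ℝ≥0∞} (hh : Measurable h) (x₀ : E)
    {R : ℝ} (hR : 0 < R) :
    ∫⁻ r in Ioo R (2 * R), sphereOscBound h x₀ R r ≤ ENNReal.ofReal R *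
      (radialConst (Module.finrank ℝ E) *
        (∫⁻ z in ball x₀ (2 * R), h z) ^ (Module.finrank ℝ E : ℝ)⁻¹) := by
  set d : ℝ := (Module.finrank ℝ E : ℝ) with hd
  have hd1 : 1 ≤ d := by
    rw [hd]; exact_mod_cast Module.finrank_pos
  have hd0 : 0 < d := by linarith
  have hdi : 0 ≤ d⁻¹ := by positivity
  set N := ∫⁻ z in ball x₀ (2 * R), h z with hN
  have hR0 : ENNReal.ofReal R ≠ 0 := by simpa using hR
  have hA : ∀ t ∈ Ioc (0 : ℝ) 1,
      ∫⁻ r in Ioo R (2 * R), (∫⁻ z in ballShell x₀ R r t, h z) ^ d⁻¹ ≤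
        ENNReal.ofReal R * (ENNReal.ofReal (6 * t) ^ d⁻¹ * N ^ d⁻¹) := by
    intro t ht
    have hm : Measurable fun r => ∫⁻ z in ballShell x₀ R r t, h z :=
      (measurable_lintegral_ballShell hh x₀ R).comp (measurable_id.prodMk measurable_const)
    have h1 := lintegral_le_rpow_lintegral_rpow_mul (μ := volume.restrict (Ioo R (2 * R)))
      (hm.pow_const d⁻¹).aemeasurable hd1
    simp only [ENNReal.rpow_inv_rpow hd0.ne', Measure.restrict_apply_univ, Real.volume_Ioo] at h1
    have h2 := lintegral_lintegral_ballShell_le hh x₀ R t (Ioo R (2 * R))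
    calc _ ≤ _ := h1
      _ ≤ (ENNReal.ofReal (6 * R * t) * N) ^ d⁻¹ * ENNReal.ofReal (2 * R - R) ^ (1 - d⁻¹) := by
          gcongr
      _ = _ := by
          rw [show 6 * R * t = R * (6 * t) by ring, ENNReal.ofReal_mul hR.le,
            ENNReal.mul_rpow_of_nonneg _ _ hdi, ENNReal.mul_rpow_of_nonneg _ _ hdi,
            show 2 * R - R = R by ring]
          have : ENNReal.ofReal R ^ d⁻¹ * ENNReal.ofReal R ^ (1 - d⁻¹) = ENNReal.ofReal R := by
            rw [← ENNReal.rpow_add _ _ hR0 ENNReal.ofReal_ne_top]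
            simp
          calc _ = (ENNReal.ofReal R ^ d⁻¹ * ENNReal.ofReal R ^ (1 - d⁻¹)) *
                (ENNReal.ofReal (6 * t) ^ d⁻¹ * N ^ d⁻¹) := by ring
            _ = _ := by rw [this]
  calc ∫⁻ r in Ioo R (2 * R), sphereOscBound h x₀ R r
      = ∫⁻ t in Ioc (0 : ℝ) 1, ∫⁻ r in Ioo R (2 * R), ENNReal.ofReal t⁻¹ *
          (∫⁻ z in ballShell x₀ R r t, h z) ^ d⁻¹ :=
        lintegral_lintegral_swap (measurable_sphereOscBound_integrand hh x₀ R).aemeasurable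
    _ ≤ ∫⁻ t in Ioc (0 : ℝ) 1, (ENNReal.ofReal t⁻¹ * ENNReal.ofReal (6 * t) ^ d⁻¹) *
          (ENNReal.ofReal R * N ^ d⁻¹) := by
        refine setLIntegral_mono' measurableSet_Ioc fun t ht => ?_
        rw [lintegral_const_mul' _ _ ENNReal.ofReal_ne_top]
        refine (mul_le_mul_right (hA t ht) _).trans (le_of_eq ?_)
        ring
    _ = _ := by
        rw [lintegral_mul_const _ (by fun_prop), radialConst]
        ring

/-- Along a sequence of functions with bounded `d`-energy there is a radius `r` such that
infinitely many of the functions are close to their mean value on the sphere of radius `r`. -/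
theorem exists_radius_frequently_enorm_sub_average_lt [Nontrivial E] :
    ∃ K : ℝ≥0∞, K ≠ ⊤ ∧ ∀ (x₀ : E) (R : ℝ), 0 < R → ∀ (v : ℕ → E → ℝ),
      (∀ k, ContDiff ℝ 1 (v k)) → ∀ N : ℝ≥0∞,
      (∀ k, ∫⁻ z in ball x₀ (2 * R), ‖fderiv ℝ (v k) z‖ₑ ^ (Module.finrank ℝ E : ℝ) ≤ N) →
      ∃ r ∈ Ioo R (2 * R), ∀ B, K * N ^ (Module.finrank ℝ E : ℝ)⁻¹ < B →
        ∃ᶠ k in atTop, ∀ x, dist x x₀ = r → ‖v k x - ⨍ y in ball x₀ R, v k y‖ₑ < B := by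
  set d : ℝ := (Module.finrank ℝ E : ℝ) with hd
  have hd1 : 1 ≤ d := by
    rw [hd]; exact_mod_cast Module.finrank_pos
  have hd0 : 0 < d := by linarith
  set σ := volume (ball (0 : E) 1) with hσ
  have hσ0 : σ ≠ 0 := (measure_ball_pos volume _ one_pos).ne'
  have hσt : σ ≠ ⊤ := measure_ball_lt_top.ne
  have hK : 3 * σ ^ (-d⁻¹) ≠ ⊤ := ENNReal.mul_ne_top (by simp)
    (ENNReal.rpow_ne_top_of_ne_zero hσ0 hσt)
  refine ⟨3 * σ ^ (-d⁻¹) * radialConst d, ENNReal.mul_ne_top hK (radialConst_ne_top hd0), ?_⟩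
  intro x₀ R hR v hv N hN
  -- The volume of the ball scales as `R^d`, so its power `-1/d` cancels the factor `R`.
  have hconst : ENNReal.ofReal (3 * R) * volume (ball x₀ R) ^ (-d⁻¹) = 3 * σ ^ (-d⁻¹) := by
    have hR0 : ENNReal.ofReal R ≠ 0 := by simpa using hR
    have hRd : ENNReal.ofReal (R ^ Module.finrank ℝ E) = ENNReal.ofReal R ^ d := by
      rw [ENNReal.ofReal_pow hR.le, hd, ENNReal.rpow_natCast]
    rw [Measure.addHaar_ball volume x₀ hR.le, hRd, ENNReal.ofReal_mul (by norm_num),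
      ENNReal.mul_rpow_of_ne_zero
        (by simp [ENNReal.rpow_eq_zero_iff, hd0.not_gt, hR]) hσ0,
      ← ENNReal.rpow_mul, mul_neg, mul_inv_cancel₀ hd0.ne', ENNReal.rpow_neg_one]
    calc _ = ENNReal.ofReal 3 * (ENNReal.ofReal R * (ENNReal.ofReal R)⁻¹) * σ ^ (-d⁻¹) := by ring
      _ = _ := by
        rw [ENNReal.mul_inv_cancel hR0 ENNReal.ofReal_ne_top, mul_one]; simp
  set J : ℕ → ℝ → ℝ≥0∞ := fun k r =>
    3 * σ ^ (-d⁻¹) * sphereOscBound (fun z => ‖fderiv ℝ (v k) z‖ₑ ^ d) x₀ R r with hJ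
  have hmeas : ∀ k, Measurable fun z => ‖fderiv ℝ (v k) z‖ₑ ^ d := fun k =>
    ((hv k).continuous_fderiv one_ne_zero).enorm.measurable.pow_const d
  have hJm : ∀ k, Measurable (J k) := fun k =>
    (measurable_sphereOscBound (hmeas k) x₀ R).const_mul _
  have hJint : ∀ k, ∫⁻ r in Ioo R (2 * R), J k r ≤
      ENNReal.ofReal R * (3 * σ ^ (-d⁻¹) * radialConst d * N ^ d⁻¹) := by
    intro k
    rw [hJ, lintegral_const_mul' _ _ hK]
    refine (mul_le_mul_right ((lintegral_sphereOscBound_le (hmeas k) x₀ hR).trans ?_) _).trans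
      (le_of_eq (b := 3 * σ ^ (-d⁻¹) * (ENNReal.ofReal R * (radialConst d * N ^ d⁻¹))) rfl)
      |>.trans (le_of_eq (by ring))
    gcongr
    exact hN k
  -- A good radius for one `k` may be bad for another; passing to the liminf before choosing the
  -- radius makes the choice independent of `k`.
  have hfatou : ∫⁻ r in Ioo R (2 * R), liminf (fun k => J k r) atTop ≤
      ENNReal.ofReal R * (3 * σ ^ (-d⁻¹) * radialConst d * N ^ d⁻¹) :=
    (lintegral_liminf_le hJm).trans
      ((liminf_le_liminf (Eventually.of_forall hJint)).trans (by simp))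
  have hvol : volume (Ioo R (2 * R)) = ENNReal.ofReal R := by
    rw [Real.volume_Ioo]; congr 1; ring
  have hR0 : ENNReal.ofReal R ≠ 0 := by simpa using hR
  obtain ⟨r, hr, hle⟩ := exists_le_setLAverage (μ := volume) (s := Ioo R (2 * R))
    (f := fun r => liminf (fun k => J k r) atTop) (by rwa [hvol])
    (by rw [hvol]; exact ENNReal.ofReal_ne_top) (Measurable.liminf hJm).aemeasurable
  refine ⟨r, hr, fun B hB => ?_⟩
  have hlt : liminf (fun k => J k r) atTop < B := by
    refine lt_of_le_of_lt (hle.trans ?_) hB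
    rw [setLAverage_eq, hvol]
    refine (ENNReal.div_le_of_le_mul' hfatou)
  refine (frequently_lt_of_liminf_lt (by isBoundedDefault) hlt).mono fun k hk x hx => ?_
  refine lt_of_le_of_lt ((enorm_sub_average_le (hv k) hR (by rw [hx]; exact hr.2)).trans
    (le_of_eq ?_)) hk
  rw [hconst, hx]

end SphereEstimate

/-! ### Smooth truncation and zero boundary values -/

/-- A smooth function that vanishes for `t ≤ 1` and is the identity for `2 ≤ t`. -/
noncomputable def softPosPart (t : ℝ) : ℝ := t * Real.smoothTransition (t - 1)

theorem contDiff_softPosPart {n : ℕ∞} : ContDiff ℝ n softPosPart :=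
  contDiff_id.mul (Real.smoothTransition.contDiff.comp (contDiff_id.sub contDiff_const))

theorem softPosPart_of_le_one {t : ℝ} (ht : t ≤ 1) : softPosPart t = 0 := by
  simp [softPosPart, Real.smoothTransition.zero_of_nonpos (sub_nonpos.2 ht)]

theorem softPosPart_of_two_le {t : ℝ} (ht : 2 ≤ t) : softPosPart t = t := by
  simp [softPosPart, Real.smoothTransition.one_of_one_le (show (1 : ℝ) ≤ t - 1 by linarith)]

/-- By scaling, `δ * softPosPart (t / δ)` is within `2δ` of the positive part, while its derivative
keeps a bound independent of `δ`. -/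
theorem abs_posPart_sub_softPosPart_le (t : ℝ) : |max t 0 - softPosPart t| ≤ 2 := by
  rcases le_total t 0 with h | h
  · rw [softPosPart_of_le_one (by linarith), max_eq_right h]; norm_num
  rcases le_total 2 t with h2 | h2
  · rw [softPosPart_of_two_le h2, max_eq_left h]; norm_num
  · have h0 := Real.smoothTransition.nonneg (t - 1)
    have h1 := Real.smoothTransition.le_one (t - 1)
    rw [max_eq_left h, softPosPart, abs_le]
    constructor <;> nlinarith

theorem deriv_softPosPart_of_lt_one {t : ℝ} (ht : t < 1) : deriv softPosPart t = 0 := by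
  have : softPosPart =ᶠ[𝓝 t] fun _ => 0 := by
    filter_upwards [Iio_mem_nhds ht] with s hs using softPosPart_of_le_one (le_of_lt hs)
  rw [this.deriv_eq, deriv_const]

theorem deriv_softPosPart_of_two_lt {t : ℝ} (ht : 2 < t) : deriv softPosPart t = 1 := by
  have : softPosPart =ᶠ[𝓝 t] id := by
    filter_upwards [Ioi_mem_nhds ht] with s hs using softPosPart_of_two_le (le_of_lt hs)
  rw [this.deriv_eq, deriv_id]

theorem continuous_deriv_softPosPart : Continuous (deriv softPosPart) :=
  (contDiff_softPosPart (n := 1)).continuous_deriv le_rfl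

theorem exists_abs_deriv_softPosPart_le : ∃ L : ℝ, ∀ t, |deriv softPosPart t| ≤ L := by
  obtain ⟨C, hC⟩ := (isCompact_Icc (a := (1 : ℝ)) (b := 2)).exists_bound_of_continuousOn
    continuous_deriv_softPosPart.continuousOn
  refine ⟨max C 1, fun t => ?_⟩
  by_cases h1 : t < 1
  · simp [deriv_softPosPart_of_lt_one h1]
  by_cases h2 : 2 < t
  · simp [deriv_softPosPart_of_two_lt h2]
  · exact (hC t ⟨not_lt.1 h1, not_lt.1 h2⟩).trans (le_max_left _ _)

/-- Bounded multipliers that are eventually equal to the indicator of a set converge to it. -/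
theorem tendsto_lintegral_indicator_sub_smul {β F : Type*} [MeasurableSpace β]
    [NormedAddCommGroup F] [NormedSpace ℝ F] {μ : Measure β} {G : β → F} (hG : Integrable G μ)
    {S : Set β} (hS : NullMeasurableSet S μ) {c : ℕ → β → ℝ}
    (hc : ∀ k, AEStronglyMeasurable (c k) μ) {L : ℝ} (hL : ∀ k x, |c k x| ≤ L)
    (h1 : ∀ᵐ x ∂μ, ∀ᶠ k in atTop, c k x = S.indicator 1 x) :
    Integrable (S.indicator G) μ ∧
      Tendsto (fun k => ∫⁻ x, ‖S.indicator G x - c k x • G x‖ₑ ∂μ) atTop (𝓝 0) := by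
  have hGS : Integrable (S.indicator G) μ := hG.indicator₀ hS
  refine ⟨hGS, ?_⟩
  have key := tendsto_lintegral_of_dominated_convergence' (μ := μ)
    (F := fun k x => ‖S.indicator G x - c k x • G x‖ₑ)
    (f := fun _ => 0) (fun x => (1 + ENNReal.ofReal L) * ‖G x‖ₑ)
    (fun k => (hGS.aestronglyMeasurable.sub ((hc k).smul hG.aestronglyMeasurable)).enorm)
    ?_ ?_ ?_
  · simpa using key
  · refine fun k => ae_of_all _ fun x => ?_
    refine enorm_sub_le.trans ?_
    simp only
    rw [add_mul, one_mul, enorm_smul]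
    refine add_le_add (enorm_indicator_le_enorm_self _ _) ?_
    gcongr
    rw [← ofReal_norm]
    exact ENNReal.ofReal_le_ofReal (hL k x)
  · rw [lintegral_const_mul' _ _ (by simp)]
    exact ENNReal.mul_ne_top (by simp) hG.hasFiniteIntegral.ne
  · filter_upwards [h1] with x hx
    refine tendsto_const_nhds.congr' ?_
    filter_upwards [hx] with k hk
    rw [hk]
    by_cases hxS : x ∈ S <;> simp [hxS]

section ZeroTrace

set_option linter.unusedSectionVars false

variable {E : Type*} [NormedAddCommGroup E] [NormedSpace ℝ E] [FiniteDimensional ℝ E]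

/-- A smooth function that vanishes near a sphere restricts to a test function of the ball. -/
theorem isTestFunctionOn_indicator_ball {w : E → ℝ} (hw : ContDiff ℝ ∞ w) {x₀ : E} {r : ℝ}
    (h0 : ∀ x, dist x x₀ = r → ∀ᶠ y in 𝓝 x, w y = 0) :
    IsTestFunctionOn (ball x₀ r) ((ball x₀ r).indicator w) := by
  have hzero : ∀ x, r ≤ dist x x₀ → (ball x₀ r).indicator w =ᶠ[𝓝 x] fun _ => 0 := by
    intro x hx
    rcases hx.eq_or_lt with h | h
    · filter_upwards [h0 x h.symm] with y hy
      simp [indicator, hy]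
    · have : ∀ᶠ y in 𝓝 x, r < dist y x₀ :=
        (continuous_id.dist continuous_const).continuousAt.eventually (lt_mem_nhds h)
      filter_upwards [this] with y hy
      exact indicator_of_notMem (by simpa using hy.le) _
  have hts : tsupport ((ball x₀ r).indicator w) ⊆ ball x₀ r := by
    intro x hx
    by_contra hxr
    exact notMem_tsupport_iff_eventuallyEq.2 (hzero x (by simpa using hxr)) hx
  refine ⟨contDiff_iff_contDiffAt.2 fun x => ?_, ?_, hts⟩
  · by_cases hx : x ∈ ball x₀ r
    · refine hw.contDiffAt.congr_of_eventuallyEq ?_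
      filter_upwards [isOpen_ball.mem_nhds hx] with y hy using indicator_of_mem hy _
    · exact contDiffAt_const.congr_of_eventuallyEq (hzero x (by simpa using hx))
  · exact HasCompactSupport.of_support_subset_isCompact (isCompact_closedBall x₀ r)
      ((subset_tsupport _).trans (hts.trans ball_subset_closedBall))

variable [MeasureSpace E] [BorelSpace E] [(volume : Measure E).IsAddHaarMeasure]

theorem integral_mul_fderiv_eq_of_isTestFunctionOn {U : Set E} {η ζ : E → ℝ}
    (hη : IsTestFunctionOn U η) (hζ : IsTestFunctionOn U ζ) (w : E) :
    ∫ x in U, η x * fderiv ℝ ζ x w = -∫ x in U, fderiv ℝ η x w * ζ x := by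
  have hd : ∀ {u : E → ℝ}, IsTestFunctionOn U u → Continuous fun x => fderiv ℝ u x w :=
    fun hu => (hu.1.continuous_fderiv (by simp)).clm_apply continuous_const
  have hs : ∀ {u : E → ℝ}, IsTestFunctionOn U u → ∀ x ∉ U, u x = 0 := fun hu x hx =>
    image_eq_zero_of_notMem_tsupport fun h => hx (hu.2.2 h)
  rw [setIntegral_eq_integral_of_forall_compl_eq_zero fun x hx => by simp [hs hη x hx],
    setIntegral_eq_integral_of_forall_compl_eq_zero fun x hx => by simp [hs hζ x hx]]
  refine integral_mul_fderiv_eq_neg_fderiv_mul_of_integrable ?_ ?_ ?_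
    (fun x _ => hη.1.differentiable (by simp) x) (fun x _ => hζ.1.differentiable (by simp) x)
  · exact ((hd hη).mul hζ.1.continuous).integrable_of_hasCompactSupport hζ.2.1.mul_left
  · exact (hη.1.continuous.mul (hd hζ)).integrable_of_hasCompactSupport hη.2.1.mul_right
  · exact (hη.1.continuous.mul hζ.1.continuous).integrable_of_hasCompactSupport hζ.2.1.mul_left

theorem tendsto_setIntegral_mul_of_tendsto_lintegral {U : Set E} {f : ℕ → E → ℝ} {g ζ : E → ℝ}
    (hf : ∀ k, IntegrableOn (f k) U) (hg : IntegrableOn g U) (hζ : Continuous ζ)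
    (hζc : HasCompactSupport ζ)
    (h : Tendsto (fun k => ∫⁻ x in U, ‖g x - f k x‖ₑ) atTop (𝓝 0)) :
    Tendsto (fun k => ∫ x in U, f k x * ζ x) atTop (𝓝 (∫ x in U, g x * ζ x)) := by
  obtain ⟨C, hC⟩ := hζ.bounded_above_of_compact_support hζc
  have hb : ∀ {u : E → ℝ}, IntegrableOn u U → IntegrableOn (fun x => u x * ζ x) U := fun hu =>
    hu.mul_bdd hζ.aestronglyMeasurable (ae_of_all _ hC)
  refine tendsto_integral_of_L1 _ (hb hg).aestronglyMeasurable (Eventually.of_forall fun k => hb (hf k)) ?_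
  have h' := ENNReal.Tendsto.mul_const (b := ENNReal.ofReal C) h (Or.inr ENNReal.ofReal_ne_top)
  rw [zero_mul] at h'
  refine tendsto_of_tendsto_of_tendsto_of_le_of_le tendsto_const_nhds h' (fun _ => zero_le)
    fun k => ?_
  simp only
  rw [← lintegral_mul_const' _ _ ENNReal.ofReal_ne_top]
  refine lintegral_mono fun x => ?_
  rw [← sub_mul, enorm_mul, ← enorm_neg, neg_sub]
  gcongr
  rw [← ofReal_norm]
  exact ENNReal.ofReal_le_ofReal (hC x)

/-- A limit of test functions in `W^{1,1}` is in `W^{1,1}_0`. -/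
theorem memW1Zero_one_of_tendsto {U : Set E} {u : E → ℝ}
    {G : E → E →L[ℝ] ℝ} (hu : IntegrableOn u U) (hG : IntegrableOn G U) {η : ℕ → E → ℝ}
    (hη : ∀ k, IsTestFunctionOn U (η k))
    (h0 : Tendsto (fun k => ∫⁻ x in U, ‖u x - η k x‖ₑ) atTop (𝓝 0))
    (h1 : Tendsto (fun k => ∫⁻ x in U, ‖G x - fderiv ℝ (η k) x‖ₑ) atTop (𝓝 0)) :
    MemW1Zero U 1 u := by
  have hηd : ∀ k, Continuous (fderiv ℝ (η k)) := fun k => (hη k).1.continuous_fderiv (by simp)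
  refine ⟨G, ⟨hu.locallyIntegrableOn, hG.locallyIntegrableOn, fun ζ hζ w => ?_⟩,
    memLp_one_iff_integrable.2 hu, memLp_one_iff_integrable.2 hG, fun ε hε => ?_⟩
  -- Integration by parts for the test functions passes to the limit, so `G` is the weak derivative
  -- of `u`.
  · have e0 := tendsto_setIntegral_mul_of_tendsto_lintegral (ζ := fun x => fderiv ℝ ζ x w)
      (fun k => ((hη k).1.continuous.integrable_of_hasCompactSupport (hη k).2.1).integrableOn)
      hu ((hζ.1.continuous_fderiv (by simp)).clm_apply continuous_const)
      (hζ.2.1.fderiv_apply ℝ w) h0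
    have e1 := tendsto_setIntegral_mul_of_tendsto_lintegral (U := U) (ζ := ζ)
      (f := fun k x => fderiv ℝ (η k) x w) (g := fun x => G x w)
      (fun k => (((hηd k).clm_apply continuous_const).integrable_of_hasCompactSupport
        ((hη k).2.1.fderiv_apply ℝ w)).integrableOn)
      (hG.apply_continuousLinearMap w) hζ.1.continuous hζ.2.1 (by
        have h' := ENNReal.Tendsto.mul_const (b := ‖w‖ₑ) h1 (Or.inr enorm_ne_top)
        rw [zero_mul] at h'
        refine tendsto_of_tendsto_of_tendsto_of_le_of_le tendsto_const_nhds h'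
          (fun _ => zero_le) fun k => ?_
        simp only
        rw [← lintegral_mul_const' _ _ enorm_ne_top]
        refine lintegral_mono fun x => ?_
        exact (G x - fderiv ℝ (η k) x).le_opENorm w)
    refine tendsto_nhds_unique e0 (e1.neg.congr fun k => ?_)
    exact (integral_mul_fderiv_eq_of_isTestFunctionOn (hη k) hζ w).symm
  · obtain ⟨k, hk0, hk1⟩ := ((h0.eventually (gt_mem_nhds hε)).and
      (h1.eventually (gt_mem_nhds hε))).exists
    refine ⟨η k, hη k, ?_, ?_⟩
    · rwa [eLpNorm_one_eq_lintegral_enorm]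
    · rwa [eLpNorm_one_eq_lintegral_enorm]

/-- The truncations `w k` vanish near the sphere because `v k < M + δ k` there by continuity; cut
off outside the ball, they are test functions. Their gradients converge to `G` restricted to `{M <
u}`: the multipliers settle to 0 or 1 wherever `v k x` tends to `u x ≠ M`. Excluding the level set
avoids having to know that `G` vanishes on it. -/
theorem memW1Zero_posPart_of_tendsto_ae {x₀ : E} {r M : ℝ} {u : E → ℝ}
    {G : E → E →L[ℝ] ℝ} (hu : IntegrableOn u (ball x₀ r)) (hG : IntegrableOn G (ball x₀ r))
    {v : ℕ → E → ℝ} (hv : ∀ k, ContDiff ℝ ∞ (v k)) (hvM : ∀ k x, dist x x₀ = r → v k x ≤ M)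
    (h0 : Tendsto (fun k => ∫⁻ x in ball x₀ r, ‖u x - v k x‖ₑ) atTop (𝓝 0))
    (h1 : Tendsto (fun k => ∫⁻ x in ball x₀ r, ‖G x - fderiv ℝ (v k) x‖ₑ) atTop (𝓝 0))
    (hae : ∀ᵐ x ∂(volume.restrict (ball x₀ r)), Tendsto (fun k => v k x) atTop (𝓝 (u x)))
    (hM : ∀ᵐ x ∂(volume.restrict (ball x₀ r)), u x ≠ M) :
    MemW1Zero (ball x₀ r) 1 (fun x => max (u x - M) 0) := by
  obtain ⟨L, hL⟩ := exists_abs_deriv_softPosPart_le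
  set μ := (volume : Measure E).restrict (ball x₀ r) with hμ
  have : IsFiniteMeasure μ := ⟨by simp [hμ, measure_ball_lt_top]⟩
  set δ : ℕ → ℝ := fun k => 1 / ((k : ℝ) + 1) with hδ
  have hδ0 : ∀ k, 0 < δ k := fun k => by positivity
  have hδt : Tendsto δ atTop (𝓝 0) := tendsto_one_div_add_atTop_nhds_zero_nat
  set w : ℕ → E → ℝ := fun k x => δ k * softPosPart ((v k x - M) / δ k) with hw
  have hws : ∀ k, ContDiff ℝ ∞ (w k) := fun k =>
    contDiff_const.mul (contDiff_softPosPart.comp (((hv k).sub contDiff_const).div_const _))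
  have htest : ∀ k, IsTestFunctionOn (ball x₀ r) ((ball x₀ r).indicator (w k)) := by
    refine fun k => isTestFunctionOn_indicator_ball (hws k) fun x hx => ?_
    have : ∀ᶠ y in 𝓝 x, v k y < M + δ k :=
      (hv k).continuous.continuousAt.eventually
        (gt_mem_nhds (lt_of_le_of_lt (hvM k x hx) (by linarith [hδ0 k])))
    filter_upwards [this] with y hy
    rw [hw]
    simp only
    rw [softPosPart_of_le_one ((div_le_one (hδ0 k)).2 (by linarith)), mul_zero]
  have hwd : ∀ k, ∀ x ∈ ball x₀ r, fderiv ℝ ((ball x₀ r).indicator (w k)) x =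
      deriv softPosPart ((v k x - M) / δ k) • fderiv ℝ (v k) x := by
    intro k x hx
    have e : (ball x₀ r).indicator (w k) =ᶠ[𝓝 x] w k := by
      filter_upwards [isOpen_ball.mem_nhds hx] with y hy using indicator_of_mem hy _
    rw [e.fderiv_eq]
    have hin : HasFDerivAt (fun x => (v k x - M) / δ k) ((δ k)⁻¹ • fderiv ℝ (v k) x) x := by
      have := (((hv k).differentiable (by simp) x).hasFDerivAt.sub_const M).const_mul (δ k)⁻¹
      simpa only [div_eq_inv_mul] using this
    have hout : HasDerivAt softPosPart (deriv softPosPart ((v k x - M) / δ k))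
        ((v k x - M) / δ k) :=
      ((contDiff_softPosPart (n := 1)).differentiable one_ne_zero _).hasDerivAt
    have := ((hout.comp_hasFDerivAt x hin).const_mul (δ k)).fderiv
    refine this.trans ?_
    rw [smul_smul, smul_smul]
    congr 1
    field_simp [(hδ0 k).ne']
  set S : Set E := {x | M < u x} with hS
  have hum : AEMeasurable u μ := hu.aestronglyMeasurable.aemeasurable
  have hSm : NullMeasurableSet S μ := nullMeasurableSet_lt aemeasurable_const hum
  obtain ⟨hGS, hlim2⟩ := tendsto_lintegral_indicator_sub_smul (μ := μ) hG hSm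
    (c := fun k x => deriv softPosPart ((v k x - M) / δ k))
    (fun k => (continuous_deriv_softPosPart.comp
      (((hv k).continuous.sub continuous_const).div_const _)).aestronglyMeasurable)
    (fun k x => hL _) (by
      filter_upwards [hae, hM] with x hx hxM
      have hs : Tendsto (fun k => v k x - M) atTop (𝓝 (u x - M)) := hx.sub_const M
      rcases lt_or_gt_of_ne hxM with h | h
      · have hev : ∀ᶠ k in atTop, v k x - M < 0 :=
          hs.eventually (gt_mem_nhds (sub_neg.2 h))
        filter_upwards [hev] with k hk
        rw [indicator_of_notMem (by simpa [hS] using h.le), deriv_softPosPart_of_lt_one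
          (lt_of_lt_of_le (div_neg_of_neg_of_pos hk (hδ0 k)) zero_le_one)]
      · have hev : ∀ᶠ k in atTop, 0 < v k x - M - 2 * δ k := by
          have : Tendsto (fun k => v k x - M - 2 * δ k) atTop (𝓝 (u x - M - 2 * 0)) :=
            hs.sub (hδt.const_mul 2)
          exact this.eventually (lt_mem_nhds (by simpa using h))
        filter_upwards [hev] with k hk
        rw [indicator_of_mem (by simpa [hS] using h), deriv_softPosPart_of_two_lt
          ((lt_div_iff₀ (hδ0 k)).2 (by linarith)), Pi.one_apply])
  have hup : IntegrableOn (fun x => max (u x - M) 0) (ball x₀ r) :=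
    Integrable.pos_part (Integrable.sub hu (integrable_const M))
  refine memW1Zero_one_of_tendsto hup hGS htest ?_ ?_
  · have hlim : Tendsto (fun k => ∫⁻ x, ‖u x - v k x‖ₑ ∂μ +
        ENNReal.ofReal (2 * δ k) * μ univ) atTop (𝓝 0) := by
      have h2 : Tendsto (fun k => ENNReal.ofReal (2 * δ k)) atTop (𝓝 0) := by
        simpa using ENNReal.tendsto_ofReal (hδt.const_mul 2)
      simpa using h0.add (ENNReal.Tendsto.mul_const h2 (Or.inr (measure_ne_top μ univ)))
    refine tendsto_of_tendsto_of_tendsto_of_le_of_le tendsto_const_nhds hlim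
      (fun _ => zero_le) fun k => ?_
    simp only
    rw [← lintegral_const, ← lintegral_add_right _ measurable_const]
    refine setLIntegral_mono' measurableSet_ball fun x hx => ?_
    rw [indicator_of_mem hx, ← ofReal_norm, ← ofReal_norm,
      ← ENNReal.ofReal_add (norm_nonneg _) (by linarith [hδ0 k])]
    refine ENNReal.ofReal_le_ofReal ?_
    have a1 : |max (u x - M) 0 - max (v k x - M) 0| ≤ |u x - v k x| := by
      refine (abs_max_sub_max_le_abs _ _ _).trans (le_of_eq ?_)
      congr 1; ring
    have a2 : |max (v k x - M) 0 - w k x| ≤ 2 * δ k := by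
      have h3 := abs_posPart_sub_softPosPart_le ((v k x - M) / δ k)
      have h4 : max (v k x - M) 0 - w k x = δ k *
          (max ((v k x - M) / δ k) 0 - softPosPart ((v k x - M) / δ k)) := by
        rw [mul_sub, mul_max_of_nonneg _ _ (hδ0 k).le, mul_zero, mul_div_cancel₀ _ (hδ0 k).ne']
      rw [h4, abs_mul, abs_of_pos (hδ0 k), mul_comm]
      exact mul_le_mul_of_nonneg_right h3 (hδ0 k).le
    exact (abs_sub_le _ (max (v k x - M) 0) _).trans (add_le_add a1 a2)
  · have hlim1 := ENNReal.Tendsto.const_mul (a := ENNReal.ofReal L) h1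
      (Or.inr ENNReal.ofReal_ne_top)
    have hlim := hlim1.add hlim2
    rw [mul_zero, add_zero] at hlim
    refine tendsto_of_tendsto_of_tendsto_of_le_of_le tendsto_const_nhds hlim
      (fun _ => zero_le) fun k => ?_
    simp only
    have hm : AEMeasurable (fun x => ENNReal.ofReal L * ‖G x - fderiv ℝ (v k) x‖ₑ) μ :=
      ((hG.aestronglyMeasurable.sub
        ((hv k).continuous_fderiv (by simp)).aestronglyMeasurable).enorm).const_mul _
    rw [← lintegral_const_mul' _ _ ENNReal.ofReal_ne_top, ← lintegral_add_left' hm]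
    refine setLIntegral_mono' measurableSet_ball fun x hx => ?_
    rw [hwd k x hx]
    -- The first term is a bounded multiple of an `L¹` error; the second involves only the fixed
    -- `G`, where dominated convergence applies.
    have e : S.indicator G x - deriv softPosPart ((v k x - M) / δ k) • fderiv ℝ (v k) x =
        deriv softPosPart ((v k x - M) / δ k) • (G x - fderiv ℝ (v k) x) +
        (S.indicator G x - deriv softPosPart ((v k x - M) / δ k) • G x) := by
      rw [smul_sub]; abel
    rw [e]
    refine (enorm_add_le (E := E →L[ℝ] ℝ) _ _).trans ?_
    rw [enorm_smul]
    refine add_le_add (mul_le_mul_left ?_ _) le_rfl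
    rw [← ofReal_norm]
    exact ENNReal.ofReal_le_ofReal (hL _)

/-- The positive part of `u - M` has zero trace on a ball when `u` is a limit in `W^{1,1}` of
smooth functions that are at most `M` on the sphere. -/
theorem memW1Zero_posPart_of_tendsto {x₀ : E} {r M : ℝ} {u : E → ℝ}
    {G : E → E →L[ℝ] ℝ} (hu : IntegrableOn u (ball x₀ r)) (hG : IntegrableOn G (ball x₀ r))
    {v : ℕ → E → ℝ} (hv : ∀ k, ContDiff ℝ ∞ (v k)) (hvM : ∀ k x, dist x x₀ = r → v k x ≤ M)
    (h0 : Tendsto (fun k => ∫⁻ x in ball x₀ r, ‖u x - v k x‖ₑ) atTop (𝓝 0))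
    (h1 : Tendsto (fun k => ∫⁻ x in ball x₀ r, ‖G x - fderiv ℝ (v k) x‖ₑ) atTop (𝓝 0))
    (hM : ∀ᵐ x ∂(volume.restrict (ball x₀ r)), u x ≠ M) :
    MemW1Zero (ball x₀ r) 1 (fun x => max (u x - M) 0) := by
  have hm : TendstoInMeasure (volume.restrict (ball x₀ r)) v atTop u := by
    refine tendstoInMeasure_of_tendsto_eLpNorm one_ne_zero
      (fun k => (hv k).continuous.aestronglyMeasurable) hu.aestronglyMeasurable ?_
    refine h0.congr fun k => ?_
    rw [eLpNorm_one_eq_lintegral_enorm]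
    refine lintegral_congr fun x => ?_
    rw [Pi.sub_apply, ← enorm_neg, neg_sub]
  obtain ⟨ns, hns, hae⟩ := hm.exists_seq_tendsto_ae
  exact memW1Zero_posPart_of_tendsto_ae hu hG (fun k => hv (ns k)) (fun k => hvM (ns k))
    (h0.comp hns.tendsto_atTop) (h1.comp hns.tendsto_atTop) hae hM

end ZeroTrace

/-! ### From spheres to balls: essential oscillation -/

section LocalOscillation

set_option linter.unusedSectionVars false

theorem HasWeakDerivOn.mono {E : Type*} [NormedAddCommGroup E] [NormedSpace ℝ E] [MeasureSpace E]
    {U W : Set E} {u : E → ℝ} {G : E → E →L[ℝ] ℝ} (h : HasWeakDerivOn U u G)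
    (hU : MeasurableSet U) (hWU : W ⊆ U) : HasWeakDerivOn W u G := by
  refine ⟨h.1.mono_set hWU, h.2.1.mono_set hWU, fun η hη v => ?_⟩
  have hη0 : ∀ x ∉ W, x ∉ tsupport η := fun x hx hx' => hx (hη.2.2 hx')
  have h1 : ∫ x in U, u x * fderiv ℝ η x v = ∫ x in W, u x * fderiv ℝ η x v := by
    refine setIntegral_eq_of_subset_of_forall_sdiff_eq_zero hU hWU fun x hx => ?_
    have : fderiv ℝ η x = 0 :=
      image_eq_zero_of_notMem_tsupport fun hx' => hη0 x hx.2 (tsupport_fderiv_subset ℝ hx')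
    simp [this]
  have h2 : ∫ x in U, G x v * η x = ∫ x in W, G x v * η x := by
    refine setIntegral_eq_of_subset_of_forall_sdiff_eq_zero hU hWU fun x hx => ?_
    simp [image_eq_zero_of_notMem_tsupport (hη0 x hx.2)]
  rw [← h1, ← h2]
  exact h.2.2 η ⟨hη.1, hη.2.1, hη.2.2.trans hWU⟩ v

variable {E : Type*} [NormedAddCommGroup E] [NormedSpace ℝ E] [FiniteDimensional ℝ E]
  [MeasureSpace E] [BorelSpace E] [(volume : Measure E).IsAddHaarMeasure]

/-- Smooth approximation in `W^{1,1}` with control of the `p`-energy. -/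
theorem exists_smooth_approx {x₀ : E} {R : ℝ} (hR : 0 < R) {u : E → ℝ} {G : E → E →L[ℝ] ℝ}
    (h : HasWeakDerivOn (ball x₀ (3 * R)) u G) (hu : IntegrableOn u (ball x₀ (3 * R)))
    (hG : IntegrableOn G (ball x₀ (3 * R))) {p : ℝ} (hp : 1 ≤ p) :
    ∃ v : ℕ → E → ℝ, (∀ k, ContDiff ℝ ∞ (v k)) ∧
      Tendsto (fun k => ∫⁻ x in ball x₀ (2 * R), ‖u x - v k x‖ₑ) atTop (𝓝 0) ∧
      Tendsto (fun k => ∫⁻ x in ball x₀ (2 * R), ‖G x - fderiv ℝ (v k) x‖ₑ) atTop (𝓝 0) ∧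
      ∀ k, ∫⁻ x in ball x₀ (2 * R), ‖fderiv ℝ (v k) x‖ₑ ^ p ≤
        ∫⁻ x in ball x₀ (3 * R), ‖G x‖ₑ ^ p := by
  have hsub : ball x₀ (2 * R) ⊆ ball x₀ (3 * R) := ball_subset_ball (by linarith)
  -- Mollification radii stay at most `R`, so that values in `ball x₀ (2 * R)` only see `ball x₀ (3
  -- * R)`.
  let s : ℕ → ℝ := fun k => R * (1 / ((k : ℝ) + 1))
  have hs0 : ∀ k, 0 < s k := fun k => by positivity
  have hsR : ∀ k, s k ≤ R := fun k => mul_le_of_le_one_right hR.le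
    ((div_le_one (by positivity)).2 (by have : (0 : ℝ) ≤ k := k.cast_nonneg; linarith))
  let ρ : ℕ → ContDiffBump (0 : E) := fun k =>
    ⟨s k / 2, s k, half_pos (hs0 k), half_lt_self (hs0 k)⟩
  have hρ : Tendsto (fun k => (ρ k).rOut) atTop (𝓝 0) := by
    simpa [ρ, s] using (tendsto_one_div_add_atTop_nhds_zero_nat (𝕜 := ℝ)).const_mul R
  have hui : Integrable ((ball x₀ (3 * R)).indicator u) volume :=
    (integrable_indicator_iff measurableSet_ball).2 hu
  have hGi : Integrable ((ball x₀ (3 * R)).indicator G) volume :=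
    (integrable_indicator_iff (ε' := E →L[ℝ] ℝ) (f := G) measurableSet_ball).2 hG
  have hd : ∀ k, ∀ x ∈ ball x₀ (2 * R), fderiv ℝ (mollify (ρ k) ((ball x₀ (3 * R)).indicator u)) x
      = mollify (ρ k) ((ball x₀ (3 * R)).indicator G) x := by
    intro k x hx
    refine fderiv_mollify_indicator measurableSet_ball h hu hG (ρ k) fun y hy => ?_
    have h1 := mem_closedBall.1 hy
    have h2 := mem_ball.1 hx
    have h3 := dist_triangle y x x₀
    have h4 : (ρ k).rOut ≤ R := hsR k
    exact mem_ball.2 (by linarith)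
  refine ⟨fun k => mollify (ρ k) ((ball x₀ (3 * R)).indicator u),
    fun k => contDiff_mollify (ρ k) hui.locallyIntegrable, ?_, ?_, fun k => ?_⟩
  · refine (tendsto_lintegral_mollify_sub hρ hui (s := ball x₀ (2 * R))
      measure_ball_lt_top.ne).congr fun k => ?_
    refine setLIntegral_congr_fun measurableSet_ball fun x hx => ?_
    simp only
    rw [indicator_of_mem (hsub hx), ← enorm_neg, neg_sub]
  · refine (tendsto_lintegral_mollify_sub hρ hGi (s := ball x₀ (2 * R))
      measure_ball_lt_top.ne).congr fun k => ?_
    refine setLIntegral_congr_fun measurableSet_ball fun x hx => ?_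
    simp only
    rw [hd k x hx, indicator_of_mem (hsub hx), ← enorm_neg, neg_sub]
  · calc ∫⁻ x in ball x₀ (2 * R), ‖fderiv ℝ (mollify (ρ k) ((ball x₀ (3 * R)).indicator u)) x‖ₑ ^ p
        = ∫⁻ x in ball x₀ (2 * R), ‖mollify (ρ k) ((ball x₀ (3 * R)).indicator G) x‖ₑ ^ p := by
          refine setLIntegral_congr_fun measurableSet_ball fun x hx => ?_
          rw [hd k x hx]
      _ ≤ ∫⁻ x, ‖mollify (ρ k) ((ball x₀ (3 * R)).indicator G) x‖ₑ ^ p :=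
          setLIntegral_le_lintegral _ _
      _ ≤ ∫⁻ x, ‖(ball x₀ (3 * R)).indicator G x‖ₑ ^ p :=
          lintegral_mollify_rpow_le (ρ k) hGi.aestronglyMeasurable hp
      _ = ∫⁻ x in ball x₀ (3 * R), ‖G x‖ₑ ^ p := by
          rw [← lintegral_indicator measurableSet_ball]
          refine lintegral_congr fun x => ?_
          by_cases hx : x ∈ ball x₀ (3 * R)
          · simp [hx]
          · simp only [indicator_of_notMem hx]
            exact (congrArg (· ^ p) (enorm_zero (E := E →L[ℝ] ℝ))).trans (ENNReal.zero_rpow_of_pos (by linarith))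

/-- On a suitable sphere, infinitely many of the functions of an approximating sequence are close
to the mean value of the limit. -/
theorem exists_radius_frequently_abs_sub_lt [Nontrivial E] :
    ∃ K : ℝ≥0∞, K ≠ ⊤ ∧ ∀ (x₀ : E) (R : ℝ), 0 < R → ∀ (u : E → ℝ) (v : ℕ → E → ℝ) (N : ℝ≥0∞),
      IntegrableOn u (ball x₀ (2 * R)) → (∀ k, ContDiff ℝ ∞ (v k)) →
      Tendsto (fun k => ∫⁻ x in ball x₀ (2 * R), ‖u x - v k x‖ₑ) atTop (𝓝 0) →
      (∀ k, ∫⁻ z in ball x₀ (2 * R), ‖fderiv ℝ (v k) z‖ₑ ^ (Module.finrank ℝ E : ℝ) ≤ N) →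
      ∃ c : ℝ, ∃ r ∈ Ioo R (2 * R), ∀ b : ℝ,
        K * N ^ (Module.finrank ℝ E : ℝ)⁻¹ < ENNReal.ofReal b →
        ∃ᶠ k in atTop, ∀ x, dist x x₀ = r → |v k x - c| < b := by
  obtain ⟨K, hK, H⟩ := exists_radius_frequently_enorm_sub_average_lt (E := E)
  refine ⟨K, hK, fun x₀ R hR u v N hu hv huv hN => ?_⟩
  obtain ⟨r, hr, hfreq⟩ := H x₀ R hR v (fun k => (hv k).of_le (by simp)) N hN
  have hsub : ball x₀ R ⊆ ball x₀ (2 * R) := ball_subset_ball (by linarith)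
  have hvi : ∀ k, IntegrableOn (v k) (ball x₀ R) := fun k =>
    ((hv k).continuous.continuousOn.integrableOn_compact (isCompact_closedBall x₀ R)).mono_set
      ball_subset_closedBall
  have hc : Tendsto (fun k => ⨍ y in ball x₀ R, v k y) atTop (𝓝 (⨍ y in ball x₀ R, u y)) := by
    simp only [average_eq]
    refine Tendsto.const_smul ?_ _
    refine tendsto_integral_of_L1 _ (hu.mono_set hsub).aestronglyMeasurable
      (Eventually.of_forall hvi) ?_
    refine tendsto_of_tendsto_of_tendsto_of_le_of_le tendsto_const_nhds huv (fun _ => zero_le)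
      fun k => ?_
    refine (lintegral_mono_set hsub).trans (le_of_eq (lintegral_congr fun x => ?_))
    rw [← enorm_neg, neg_sub]
  refine ⟨⨍ y in ball x₀ R, u y, r, hr, fun b hb => ?_⟩
  -- The gap `b - b'` absorbs the difference between the means of `v k` and the mean of `u`.
  obtain ⟨b', hb'0, hb', hb'b⟩ := ENNReal.lt_iff_exists_real_btwn.1 hb
  have hlt : b' < b := (ENNReal.ofReal_lt_ofReal_iff_of_nonneg hb'0).1 hb'b
  have hev : ∀ᶠ k in atTop, |(⨍ y in ball x₀ R, v k y) - ⨍ y in ball x₀ R, u y| < b - b' := by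
    simpa [Real.dist_eq] using (Metric.tendsto_nhds.1 hc) (b - b') (by linarith)
  refine ((hfreq _ hb').and_eventually hev).mono fun k hk x hx => ?_
  have h1 := hk.1 x hx
  rw [← ofReal_norm, Real.norm_eq_abs, ENNReal.ofReal_lt_ofReal_iff_of_nonneg (abs_nonneg _)] at h1
  have h2 := abs_sub_le (v k x) (⨍ y in ball x₀ R, v k y) (⨍ y in ball x₀ R, u y)
  linarith [hk.2]

theorem memW1Zero_posPart_of_frequently {x₀ : E} {R r M : ℝ} (hr : r ≤ R) {u : E → ℝ}
    {G : E → E →L[ℝ] ℝ} (hu : IntegrableOn u (ball x₀ R)) (hG : IntegrableOn G (ball x₀ R))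
    {v : ℕ → E → ℝ} (hv : ∀ k, ContDiff ℝ ∞ (v k))
    (h0 : Tendsto (fun k => ∫⁻ x in ball x₀ R, ‖u x - v k x‖ₑ) atTop (𝓝 0))
    (h1 : Tendsto (fun k => ∫⁻ x in ball x₀ R, ‖G x - fderiv ℝ (v k) x‖ₑ) atTop (𝓝 0))
    (hvM : ∃ᶠ k in atTop, ∀ x, dist x x₀ = r → v k x ≤ M)
    (hM : ∀ᵐ x ∂(volume.restrict (ball x₀ r)), u x ≠ M) :
    MemW1Zero (ball x₀ r) 1 (fun x => max (u x - M) 0) := by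
  have hsub : ball x₀ r ⊆ ball x₀ R := ball_subset_ball hr
  obtain ⟨ns, hns, hle⟩ := extraction_of_frequently_atTop hvM
  refine memW1Zero_posPart_of_tendsto (hu.mono_set hsub) (hG.mono_set hsub)
    (fun k => hv (ns k)) hle ?_ ?_ hM
  · exact tendsto_of_tendsto_of_tendsto_of_le_of_le tendsto_const_nhds
      (h0.comp hns.tendsto_atTop) (fun _ => zero_le) fun k => lintegral_mono_set hsub
  · exact tendsto_of_tendsto_of_tendsto_of_le_of_le tendsto_const_nhds
      (h1.comp hns.tendsto_atTop) (fun _ => zero_le) fun k => lintegral_mono_set hsub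

/-- Level sets are disjoint, so at most countably many have positive measure, and the other levels
are dense. -/
theorem exists_mem_Ioo_ae_ne {β : Type*} [MeasurableSpace β] {μ : Measure β} [SFinite μ]
    {u : β → ℝ} (hu : AEMeasurable u μ) {a b : ℝ} (hab : a < b) :
    ∃ t ∈ Ioo a b, ∀ᵐ x ∂μ, u x ≠ t := by
  have hcount := Measure.countable_meas_level_set_pos₀ (μ := μ) hu.nullMeasurable
  obtain ⟨t, ht, hab'⟩ := (hcount.dense_compl ℝ).exists_between hab
  refine ⟨t, hab', ?_⟩
  rw [ae_iff]
  simpa using ht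

theorem ae_le_of_eLpNorm_top_posPart_le {β : Type*} [MeasurableSpace β] {μ : Measure β}
    {u : β → ℝ} {D : ℝ} (hD : 0 ≤ D)
    (h : eLpNorm (fun x => max (u x) 0) ∞ μ ≤ ENNReal.ofReal D) : ∀ᵐ x ∂μ, u x ≤ D := by
  rw [eLpNorm_exponent_top] at h
  filter_upwards [ae_le_eLpNormEssSup (f := fun x => max (u x) 0) (μ := μ)] with x hx
  have h1 := hx.trans h
  rw [← ofReal_norm, ENNReal.ofReal_le_ofReal_iff hD, Real.norm_eq_abs] at h1
  exact (le_max_left _ _).trans ((le_abs_self _).trans h1)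

/-- The oscillation on a ball is controlled by the energy on the threefold ball. -/
theorem exists_ae_abs_sub_le [Nontrivial E] :
    ∃ K : ℝ≥0∞, K ≠ ⊤ ∧ ∀ (x₀ : E) (R : ℝ), 0 < R → ∀ (u : E → ℝ) (G : E → E →L[ℝ] ℝ) (D : ℝ),
      HasWeakDerivOn (ball x₀ (3 * R)) u G → IntegrableOn u (ball x₀ (3 * R)) →
      IntegrableOn G (ball x₀ (3 * R)) → 0 ≤ D →
      (∀ r ∈ Ioo R (2 * R), ∀ M m : ℝ,
        MemW1Zero (ball x₀ r) 1 (fun x => max (u x - M) 0) →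
        MemW1Zero (ball x₀ r) 1 (fun x => max (m - u x) 0) →
          eLpNorm (fun x => max (u x - M) 0) ∞ (volume.restrict (ball x₀ r))
              ≤ ENNReal.ofReal D ∧
          eLpNorm (fun x => max (m - u x) 0) ∞ (volume.restrict (ball x₀ r))
              ≤ ENNReal.ofReal D) →
      ∃ c : ℝ, ∀ b : ℝ,
        K * (∫⁻ x in ball x₀ (3 * R), ‖G x‖ₑ ^ (Module.finrank ℝ E : ℝ)) ^
          (Module.finrank ℝ E : ℝ)⁻¹ < ENNReal.ofReal b →
        ∀ᵐ x ∂(volume.restrict (ball x₀ R)), |u x - c| ≤ b + D := by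
  obtain ⟨K, hK, H⟩ := exists_radius_frequently_abs_sub_lt (E := E)
  refine ⟨K, hK, fun x₀ R hR u G D h hu hG hD hmono => ?_⟩
  have hd1 : 1 ≤ (Module.finrank ℝ E : ℝ) := by exact_mod_cast Module.finrank_pos
  obtain ⟨v, hv, h0, h1, hN⟩ := exists_smooth_approx hR h hu hG hd1
  have hsub : ball x₀ (2 * R) ⊆ ball x₀ (3 * R) := ball_subset_ball (by linarith)
  have hu2 := hu.mono_set hsub
  have hG2 := hG.mono_set hsub
  obtain ⟨c, r, hr, hfreq⟩ := H x₀ R hR u v _ hu2 hv h0 hN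
  refine ⟨c, fun b hb => ?_⟩
  obtain ⟨b', hb'0, hb', hb'b⟩ := ENNReal.lt_iff_exists_real_btwn.1 hb
  have hlt : b' < b := (ENNReal.ofReal_lt_ofReal_iff_of_nonneg hb'0).1 hb'b
  have hur : AEMeasurable u (volume.restrict (ball x₀ r)) :=
    (hu2.mono_set (ball_subset_ball hr.2.le)).aestronglyMeasurable.aemeasurable
  -- The slack between `b'` and `b` leaves room to choose levels that `u` avoids almost everywhere.
  obtain ⟨M, hM, hMae⟩ := exists_mem_Ioo_ae_ne hur (show c + b' < c + b by linarith)
  obtain ⟨m, hm, hmae⟩ := exists_mem_Ioo_ae_ne hur (show c - b < c - b' by linarith)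
  have w1 : MemW1Zero (ball x₀ r) 1 (fun x => max (u x - M) 0) := by
    refine memW1Zero_posPart_of_frequently hr.2.le hu2 hG2 hv h0 h1 ?_ hMae
    refine (hfreq b' hb').mono fun k hk x hx => ?_
    linarith [(abs_lt.1 (hk x hx)).2, hM.1]
  have w2 : MemW1Zero (ball x₀ r) 1 (fun x => max (m - u x) 0) := by
    -- The lower truncation is the upper one for `-u` at level `-m`.
    have e : (fun x => max (m - u x) 0) = fun x => max ((-u) x - -m) 0 := by
      ext x; rw [Pi.neg_apply]; congr 1; ring
    rw [e]
    refine memW1Zero_posPart_of_frequently (v := fun k => -v k) (G := -G) hr.2.le hu2.neg hG2.neg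
      (fun k => (hv k).neg) (h0.congr fun k => ?_) (h1.congr fun k => ?_) ?_ ?_
    · refine lintegral_congr fun x => ?_
      rw [← enorm_neg]; congr 1; simp only [Pi.neg_apply]; ring
    · refine lintegral_congr fun x => ?_
      rw [fderiv_neg, ← enorm_neg]; congr 1; simp only [Pi.neg_apply]; abel
    · refine (hfreq b' hb').mono fun k hk x hx => ?_
      have := (abs_lt.1 (hk x hx)).1
      simp only [Pi.neg_apply]
      linarith [hm.2]
    · filter_upwards [hmae] with x hx
      simpa using hx
  obtain ⟨o1, o2⟩ := hmono r hr M m w1 w2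
  have hRr : ball x₀ R ⊆ ball x₀ r := ball_subset_ball hr.1.le
  filter_upwards [ae_restrict_of_ae_restrict_of_subset hRr (ae_le_of_eLpNorm_top_posPart_le hD o1),
    ae_restrict_of_ae_restrict_of_subset hRr (ae_le_of_eLpNorm_top_posPart_le hD o2)] with x a1 a2
  rw [abs_le]
  constructor
  · linarith [hm.1]
  · linarith [hM.2]

/-- The essential oscillation of an almost weakly monotone function of class `W^{1,n}` on small
balls tends to zero. -/
theorem IsAlmostWeaklyMonotone.exists_ball_ae_abs_sub_le [Nontrivial E] {Ω : Set E}
    (hΩ : IsOpen Ω) {u : E → ℝ} (hu : MemW1Loc Ω (Module.finrank ℝ E : ℝ≥0∞) u) {α : ℝ}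
    (hmono : IsAlmostWeaklyMonotone α Ω u) {x₀ : E} (hx₀ : x₀ ∈ Ω) {ε : ℝ} (hε : 0 < ε) :
    ∃ R > 0, ∃ c : ℝ, ∀ᵐ x ∂(volume.restrict (ball x₀ R)), |u x - c| ≤ ε := by
  obtain ⟨hα, -, C, hC, hCmono⟩ := hmono
  obtain ⟨K, hK, H⟩ := exists_ae_abs_sub_le (E := E)
  set d : ℕ := Module.finrank ℝ E with hd
  have hd1 : 1 ≤ d := Module.finrank_pos
  have hd0 : (0 : ℝ) < d := by exact_mod_cast hd1
  obtain ⟨R₀, hR₀, hball⟩ := Metric.nhds_basis_closedBall.mem_iff.1 (hΩ.mem_nhds hx₀)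
  obtain ⟨G, hG, huL, hGL⟩ := hu (ball x₀ R₀) isOpen_ball
    ((isCompact_closedBall x₀ R₀).of_isClosed_subset isClosed_closure
      closure_ball_subset_closedBall) (closure_ball_subset_closedBall.trans hball)
  have : IsFiniteMeasure ((volume : Measure E).restrict (ball x₀ R₀)) :=
    ⟨by simp [measure_ball_lt_top]⟩
  have hd1' : (1 : ℝ≥0∞) ≤ d := by exact_mod_cast hd1
  have hui : IntegrableOn u (ball x₀ R₀) := huL.integrable hd1'
  have hGi : IntegrableOn G (ball x₀ R₀) := hGL.integrable hd1'
  have hfin : ∫⁻ x in ball x₀ R₀, ‖G x‖ₑ ^ (d : ℝ) ≠ ⊤ := by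
    have := lintegral_rpow_enorm_lt_top_of_eLpNorm_lt_top (p := (d : ℝ≥0∞))
      (by simpa using (Nat.pos_iff_ne_zero.1 hd1)) (by simp) hGL.2
    simpa using this.ne
  -- Absolute continuity of the integral: the energy on `ball x₀ R₀` is finite and the measure of
  -- the shrinking balls tends to zero.
  have hE : Tendsto (fun R : ℝ => ∫⁻ x in ball x₀ (3 * R), ‖G x‖ₑ ^ (d : ℝ)
      ∂(volume.restrict (ball x₀ R₀))) (𝓝[>] 0) (𝓝 0) := by
    refine tendsto_setLIntegral_zero hfin ?_
    have hvol : Tendsto (fun R : ℝ => ENNReal.ofReal ((3 * R) ^ d) * volume (ball (0 : E) 1))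
        (𝓝[>] 0) (𝓝 0) := by
      have h1 : Tendsto (fun R : ℝ => ENNReal.ofReal ((3 * R) ^ d)) (𝓝[>] 0) (𝓝 0) := by
        have hc : Continuous fun R : ℝ => ENNReal.ofReal ((3 * R) ^ d) :=
          ENNReal.continuous_ofReal.comp (by fun_prop)
        have := (hc.tendsto 0).mono_left (nhdsWithin_le_nhds (s := Ioi 0))
        simpa [Nat.pos_iff_ne_zero.1 hd1] using this
      simpa using ENNReal.Tendsto.mul_const h1 (Or.inr measure_ball_lt_top.ne)
    refine tendsto_of_tendsto_of_tendsto_of_le_of_le' tendsto_const_nhds hvol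
      (Eventually.of_forall fun _ => zero_le) ?_
    filter_upwards [self_mem_nhdsWithin] with R hR
    have hR' : (0 : ℝ) < R := hR
    exact (Measure.restrict_apply_le _ _).trans
      (Measure.addHaar_ball volume x₀ (by linarith)).le
  have hE' : Tendsto (fun R : ℝ => K * (∫⁻ x in ball x₀ (3 * R), ‖G x‖ₑ ^ (d : ℝ)
      ∂(volume.restrict (ball x₀ R₀))) ^ (d : ℝ)⁻¹) (𝓝[>] 0) (𝓝 0) := by
    have h1 := (ENNReal.continuous_rpow_const (y := (d : ℝ)⁻¹)).tendsto 0 |>.comp hE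
    rw [ENNReal.zero_rpow_of_pos (by positivity)] at h1
    simpa using ENNReal.Tendsto.const_mul h1 (Or.inr hK)
  -- The good radius is known only to be below `2R`, hence `2 * R` in place of `r`.
  have hD : Tendsto (fun R : ℝ => C * (2 * R) ^ α) (𝓝[>] 0) (𝓝 0) := by
    have hc : Continuous fun R : ℝ => C * (2 * R) ^ α :=
      continuous_const.mul ((continuous_const.mul continuous_id).rpow_const fun _ => Or.inr hα.le)
    have := (hc.tendsto 0).mono_left (nhdsWithin_le_nhds (s := Ioi 0))
    simpa [Real.zero_rpow hα.ne'] using this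
  have hsmall : ∀ᶠ R : ℝ in 𝓝[>] 0, 3 * R < R₀ := by
    have hc : Continuous fun R : ℝ => 3 * R := by fun_prop
    have := (hc.tendsto 0).mono_left (nhdsWithin_le_nhds (s := Ioi 0))
    exact this.eventually (gt_mem_nhds (by simpa using hR₀))
  obtain ⟨R, hRpos, hR3, hRE, hRD⟩ := ((eventually_mem_nhdsWithin (a := 0)).and (hsmall.and
    ((hE'.eventually (gt_mem_nhds (show (0 : ℝ≥0∞) < ENNReal.ofReal (ε / 2) by simpa using hε))).and
      (hD.eventually (gt_mem_nhds (half_pos hε)))))).exists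
  have hRpos' : (0 : ℝ) < R := hRpos
  have hsub : ball x₀ (3 * R) ⊆ ball x₀ R₀ := ball_subset_ball hR3.le
  rw [Measure.restrict_restrict_of_subset hsub] at hRE
  obtain ⟨c, hc⟩ := H x₀ R hRpos' u G (C * (2 * R) ^ α) (hG.mono measurableSet_ball hsub)
    (hui.mono_set hsub) (hGi.mono_set hsub) (by positivity) fun r hr M m w1 w2 => by
      have hr0 : 0 < r := hRpos'.trans hr.1
      obtain ⟨o1, o2⟩ := hCmono x₀ r hr0
        ((closedBall_subset_closedBall (by linarith [hr.2])).trans hball) M m w1 w2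
      have hle : ENNReal.ofReal (C * r ^ α) ≤ ENNReal.ofReal (C * (2 * R) ^ α) := by
        refine ENNReal.ofReal_le_ofReal ?_
        gcongr
        exact hr.2.le
      exact ⟨o1.trans hle, o2.trans hle⟩
  refine ⟨R, hRpos', c, ?_⟩
  filter_upwards [hc (ε / 2) hRE] with x hx
  linarith

end LocalOscillation

/-! ### Continuous representatives -/

/-- A function whose essential oscillation on small balls tends to zero agrees almost everywhere
with a continuous function. -/
theorem exists_continuousOn_ae_eq_of_small_oscillation {X : Type*} [PseudoMetricSpace X]
    [SecondCountableTopology X] [MeasurableSpace X] [OpensMeasurableSpace X] {μ : Measure X}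
    [μ.IsOpenPosMeasure] {Ω : Set X} (hΩ : IsOpen Ω) {u : X → ℝ}
    (h : ∀ x₀ ∈ Ω, ∀ ε > 0, ∃ R > 0, ∃ c : ℝ, ∀ᵐ x ∂(μ.restrict (ball x₀ R)), |u x - c| ≤ ε) :
    ∃ ψ : X → ℝ, ContinuousOn ψ Ω ∧ ∀ᵐ x ∂(μ.restrict Ω), u x = ψ x := by
  -- Limits along `𝓝 x ⊓ ae μ` ignore null sets. The filter is nontrivial because neighbourhoods
  -- have positive measure, so such limits are unique and inherit bounds that hold almost
  -- everywhere.
  have hne : ∀ x : X, (𝓝 x ⊓ ae μ).NeBot := by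
    intro x
    rw [inf_neBot_iff]
    intro s hs t ht
    by_contra hempty
    have hst : s ⊆ tᶜ := fun y hy hyt => hempty ⟨y, hy, hyt⟩
    exact (Measure.measure_pos_of_mem_nhds μ hs).ne' (measure_mono_null hst (by simpa [mem_ae_iff] using ht))
  have hball : ∀ {x y : X} {R : ℝ} {p : X → Prop}, (∀ᵐ z ∂(μ.restrict (ball x R)), p z) →
      y ∈ ball x R → ∀ᶠ z in 𝓝 y ⊓ ae μ, p z := by
    intro x y R p hp hy
    rw [ae_restrict_iff' measurableSet_ball] at hp
    exact (hp.filter_mono inf_le_right).mp (((isOpen_ball.eventually_mem hy).filter_mono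
      inf_le_left).mono fun z hz hzp => hzp hz)
  -- Small essential oscillation makes the image of this filter under `u` Cauchy; its limit is the
  -- value of the representative.
  have hex : ∀ x ∈ Ω, ∃ l : ℝ, Tendsto u (𝓝 x ⊓ ae μ) (𝓝 l) := by
    intro x hx
    have := hne x
    refine cauchy_map_iff_exists_tendsto.1 (Metric.cauchy_iff.2 ⟨inferInstance, fun ε hε => ?_⟩)
    obtain ⟨R, hR, c, hc⟩ := h x hx (ε / 3) (by positivity)
    refine ⟨closedBall c (ε / 3), ?_, fun a ha b hb => ?_⟩
    · exact (hball hc (mem_ball_self hR)).mono fun z hz => hz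
    · have := dist_triangle_right a b c
      have := mem_closedBall.1 ha
      have := mem_closedBall.1 hb
      linarith
  choose! ψ hψ using hex
  have hclose : ∀ x₀ ∈ Ω, ∀ ε > 0, ∃ R > 0, ball x₀ R ⊆ Ω ∧ ∃ c : ℝ,
      (∀ᵐ x ∂(μ.restrict (ball x₀ R)), |u x - c| ≤ ε) ∧ ∀ x ∈ ball x₀ R, |ψ x - c| ≤ ε := by
    intro x₀ hx₀ ε hε
    obtain ⟨R₁, hR₁, hsub⟩ := Metric.isOpen_iff.1 hΩ x₀ hx₀
    obtain ⟨R₂, hR₂, c, hc⟩ := h x₀ hx₀ ε hε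
    have hc' := ae_restrict_of_ae_restrict_of_subset
      (ball_subset_ball (min_le_right R₁ R₂) : ball x₀ (min R₁ R₂) ⊆ ball x₀ R₂) hc
    refine ⟨min R₁ R₂, lt_min hR₁ hR₂, (ball_subset_ball (min_le_left _ _)).trans hsub, c, hc',
      fun x hx => ?_⟩
    have := hne x
    exact le_of_tendsto ((hψ x (hsub (ball_subset_ball (min_le_left _ _) hx))).sub_const c).abs
      (hball hc' hx)
  refine ⟨ψ, fun x₀ hx₀ => ContinuousAt.continuousWithinAt ?_, ?_⟩
  · rw [Metric.continuousAt_iff]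
    intro ε hε
    obtain ⟨R, hR, -, c, -, hψc⟩ := hclose x₀ hx₀ (ε / 3) (by positivity)
    refine ⟨R, hR, fun {x} hx => ?_⟩
    have h1 := hψc x hx
    have h2 := hψc x₀ (mem_ball_self hR)
    rw [abs_sub_comm] at h2
    rw [Real.dist_eq]
    linarith [abs_sub_le (ψ x) c (ψ x₀)]
  · have hk : ∀ k : ℕ, ∀ᵐ x ∂(μ.restrict Ω), |u x - ψ x| ≤ 1 / ((k : ℝ) + 1) := by
      intro k
      have hδ : (0 : ℝ) < 1 / ((k : ℝ) + 1) := by positivity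
      rw [ae_restrict_iff' hΩ.measurableSet, ae_iff]
      -- It suffices to work near each point, where `u` (almost everywhere) and `ψ` (everywhere) are
      -- both within half the tolerance of the same `c`.
      refine measure_null_of_locally_null _ fun x₀ hx₀ => ?_
      have hx₀' : x₀ ∈ Ω := by by_contra hn; exact hx₀ fun hh => absurd hh hn
      obtain ⟨R, hR, -, c, hc, hψc⟩ := hclose x₀ hx₀' _ (half_pos hδ)
      refine ⟨_, inter_mem_nhdsWithin _ (ball_mem_nhds x₀ hR), ?_⟩
      rw [ae_restrict_iff' measurableSet_ball, ae_iff] at hc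
      refine measure_mono_null (fun x hx => ?_) hc
      intro hx'
      refine hx.1 fun _ => ?_
      have h1 := hx' hx.2
      have h2 := hψc x hx.2
      rw [abs_sub_comm] at h2
      linarith [abs_sub_le (u x) c (ψ x)]
    filter_upwards [ae_all_iff.2 hk] with x hx
    have h0 : |u x - ψ x| ≤ 0 :=
      ge_of_tendsto' tendsto_one_div_add_atTop_nhds_zero_nat hx
    exact sub_eq_zero.1 (abs_nonpos_iff.1 h0)

theorem proposition1p4 (n : ℕ) (hn : 2 ≤ n) (Ω : Set (EuclideanSpace ℝ (Fin n)))
    (hΩ : IsOpen Ω) (φ : EuclideanSpace ℝ (Fin n) → ℝ) (hφ : MemW1Loc Ω (n : ℝ≥0∞) φ)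
    (α : ℝ) (hmono : IsAlmostWeaklyMonotone α Ω φ) :
    ∃ ψ : EuclideanSpace ℝ (Fin n) → ℝ,
      ContinuousOn ψ Ω ∧ ∀ᵐ x ∂(volume.restrict Ω), φ x = ψ x := by
  have hfin : Module.finrank ℝ (EuclideanSpace ℝ (Fin n)) = n := finrank_euclideanSpace_fin
  have : Nontrivial (EuclideanSpace ℝ (Fin n)) :=
    Module.nontrivial_of_finrank_pos (R := ℝ) (by omega)
  refine exists_continuousOn_ae_eq_of_small_oscillation hΩ fun x₀ hx₀ ε hε => ?_
  exact hmono.exists_ball_ae_abs_sub_le hΩ (by rwa [hfin]) hx₀ hε
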